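/- \textbf{Definitions.} A bipartite graph $X=(V_0,V_1,E)$, $E\subseteq V_0\times V_1$, with $V_0,V_1$ finite, is $(w_0,w_1)$-regular if every vertex of $V_0$ has $w_0$ neighbours and every vertex of $V_1$ has $w_1$ neighbours. A $(w_0,w_1)$-regular $X$ is a 2-sided $(c,\epsilon)$-lossless expander if every $S\subseteq V_0$ with $|S|<c|V_0|$ has at least $(1-\epsilon)w_0|S|$ neighbours in $V_1$, and every $S\subseteq V_1$ with $|S|<c|V_1|$ has at least $(1-\epsilon)w_1|S|$ neighbours in $V_0$. A free $G$-action on $X$ consists of free actions of $G$ on $V_0$ and on $V_1$ that preserve $E$. A quantum CSS code is given by matrices $H_x,H_z$ over $\mathbb F_2$ with $n$ columns (the qubits) and $H_xH_z^T=0$. Its dimension is $k=n-\operatorname{rank}H_x-\operatorname{rank}H_z$; its distance $d$ is the minimal number of qubits on which a nontrivial logical operator (a Pauli string that commutes with all the stabilizers and is, up to a phase, not itself a stabilizer) acts nontrivially; its weight is the maximal weight of the rows and columns of $H_x$ and $H_z$. For bipartite graphs $X_\updownarrow=(V_{0*},V_{1*},E_\updownarrow)$ and $X_\leftrightarrow=(V_{*0},V_{*1},E_\leftrightarrow)$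 with free actions of the same finite group $G$, the balanced product $X_\updownarrow\times_G X_\leftrightarrow$ has vertex sets $V_{\alpha\beta}=(V_{\alpha*}\times V_{*\beta})/G$ (quotients by the diagonal action) and edges $[x_0,y]\sim[x_1,y]$ for $(x_0,x_1)\in E_\updownarrow$, $y\in V_{*\beta}$, and $[x,y_0]\sim[x,y_1]$ for $x\in V_{\alpha*}$, $(y_0,y_1)\in E_\leftrightarrow$. Its adjacency matrices give a chain complex $\mathbb F_2^{V_{00}}\xrightarrow{\partial_2}\mathbb F_2^{V_{10}}\oplus\mathbb F_2^{V_{01}}\xrightarrow{\partial_1}\mathbb F_2^{V_{11}}$. Its CSS code has $V_{10}\sqcup V_{01}$ as qubits, $V_{11}$ as X-stabilizers and $V_{00}$ as Z-stabilizers, the stabilizer of a vertex acting on the neighbours of that vertex. \textbf{Conjecture 1.} There is a sequence of finite groups $G_i$ with $|G_i|\to\infty$ such that for every $\epsilon>0$ and every nonempty open interval $I\subseteq(0,1)$ there are $w_0,w_1\in\mathbb N$, $c>0$, constants $0<\kappa_1\le\kappa_2$ and $i_0$ such that $w_0/w_1\in I$ and for every $i\ge i_0$ there is a $(w_0,w_1)$-regular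 bipartite graph $X=(V_0,V_1,E)$ with a free $G_i$-action that is a 2-sided $(c,\epsilon)$-lossless expander and has $\kappa_1|G_i|\le|V_0|\le\kappa_2|G_i|$. \textbf{Theorem 1.} Assume Conjecture 1. Then for every $0<r<1$ there are $\delta>0$, $w\in\mathbb N$ and an infinite sequence of CSS codes $C_i$ with parameters $[[n_i,k_i,d_i]]$ such that $n_i\to\infty$ and, for all $i$, $k_i/n_i\ge r$, $d_i/n_i\ge\delta$ and $C_i$ has weight $w$. Moreover, $C_i$ can be taken to be the CSS code of a balanced product $X^{(i)}_\updownarrow\times_{G_i}X^{(i)}_\leftrightarrow$, where the $G_i$ are finite groups with $|G_i|\to\infty$ (not necessarily the sequence of Conjecture 1), $X^{(i)}_\updownarrow$ and $X^{(i)}_\leftrightarrow$ are bipartite graphs with free $G_i$-actions, and, with parameters that do not depend on $i$: $X^{(i)}_\updownarrow$ is a $(w_\downarrow,w_\uparrow)$-regular 2-sided $(c_\updownarrow,\epsilon_\updownarrow)$-lossless expander, $X^{(i)}_\leftrightarrow$ is a $(w_\rightarrow,w_\leftarrow)$-regular 2-sided $(c_\leftrightarrow,\epsilon_\leftrightarrow)$-lossless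 expander, $c_\updownarrow,c_\leftrightarrow,\epsilon_\updownarrow,\epsilon_\leftrightarrow>0$, $|V^{(i)}_{0*}|=\Theta(|G_i|)$, $|V^{(i)}_{*0}|=\Theta(|G_i|)$, $$\frac{(w_\downarrow-w_\uparrow)(w_\leftarrow-w_\rightarrow)}{w_\downarrow w_\leftarrow+w_\uparrow w_\rightarrow}\ge r,\qquad \epsilon_\updownarrow w_\downarrow\le w_\uparrow,\quad \epsilon_\updownarrow w_\uparrow\le w_\downarrow,\qquad w_\uparrow\epsilon_\leftrightarrow,\ w_\downarrow\epsilon_\leftrightarrow,\ \epsilon_\leftrightarrow,\ \epsilon_\updownarrow<\tfrac1{12}.$$ -/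

import Mathlib

open Filter Finset
open scoped Matrix

/-- A finite bipartite graph with vertex sets `V₀`, `V₁` and edge set `E ⊆ V₀ × V₁`, together with
an edge-preserving action of the group `G` that is free on `V₀` and on `V₁`. -/
structure FreeBipartiteGraph (G : Type) [Group G] where
  V₀ : Type
  V₁ : Type
  [fintype₀ : Fintype V₀]
  [fintype₁ : Fintype V₁]
  [action₀ : MulAction G V₀]
  [action₁ : MulAction G V₁]
  E : V₀ → V₁ → Prop
  E_smul : ∀ (g : G) (x₀ : V₀) (x₁ : V₁), E x₀ x₁ → E (g • x₀) (g • x₁)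
  free₀ : ∀ (g : G) (x₀ : V₀), g • x₀ = x₀ → g = 1
  free₁ : ∀ (g : G) (x₁ : V₁), g • x₁ = x₁ → g = 1

attribute [instance] FreeBipartiteGraph.fintype₀ FreeBipartiteGraph.fintype₁
  FreeBipartiteGraph.action₀ FreeBipartiteGraph.action₁

section Expansion

variable {A B : Type} [Fintype A] [Fintype B]

open Classical in
/-- The set of vertices of `B` that are adjacent to some vertex of `S ⊆ A`. -/
noncomputable def neighbors (E : A → B → Prop) (S : Finset A) : Finset B :=
  univ.filter fun b => ∃ a ∈ S, E a b

open Classical in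
/-- The bipartite graph is `(w₀, w₁)`-regular. -/
def IsBiregular (E : A → B → Prop) (w₀ w₁ : ℕ) : Prop :=
  (∀ a, #{b | E a b} = w₀) ∧ (∀ b, #{a | E a b} = w₁)

/-- `(c, α)`-vertex expansion from `A` to `B`. -/
def HasVertexExpansion (E : A → B → Prop) (c α : ℝ) : Prop :=
  ∀ S : Finset A, (#S : ℝ) < c * Fintype.card A → α * #S ≤ #(neighbors E S)

/-- A `(w₀, w₁)`-regular bipartite graph that is a 2-sided `(c, ε)`-lossless expander. -/
def IsLosslessExpander (E : A → B → Prop) (w₀ w₁ : ℕ) (c ε : ℝ) : Prop :=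
  IsBiregular E w₀ w₁ ∧
    HasVertexExpansion E c ((1 - ε) * w₀) ∧
    HasVertexExpansion (fun b a => E a b) c ((1 - ε) * w₁)

end Expansion

/-- The conjecture that 2-sided lossless expanders with free group action exist. The intervals are
the nonempty open intervals `(a, b) ⊆ (0, 1)`; `κ₁, κ₂` are the constants of `|V₀| = Θ(|G|)`. -/
def LosslessExpanderConjecture : Prop :=
  ∃ (G : ℕ → Type) (_ : ∀ i, Group (G i)) (_ : ∀ i, Fintype (G i)),
    Tendsto (fun i => Fintype.card (G i)) atTop atTop ∧
    ∀ ε : ℝ, 0 < ε → ∀ a b : ℝ, 0 ≤ a → a < b → b ≤ 1 →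
      ∃ (w₀ w₁ : ℕ) (c κ₁ κ₂ : ℝ) (i₀ : ℕ), 0 < c ∧ 0 < κ₁ ∧
        a < (w₀ : ℝ) / w₁ ∧ (w₀ : ℝ) / w₁ < b ∧
        ∀ i, i₀ ≤ i → ∃ X : FreeBipartiteGraph (G i),
          IsLosslessExpander X.E w₀ w₁ c ε ∧
          κ₁ * Fintype.card (G i) ≤ Fintype.card X.V₀ ∧
          Fintype.card X.V₀ ≤ κ₂ * Fintype.card (G i)

/-- A quantum CSS code, given by the parity-check matrices of its X- and Z-stabilizers. -/
structure CSSCode where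
  Qubit : Type
  XCheck : Type
  ZCheck : Type
  [fintypeQubit : Fintype Qubit]
  [fintypeXCheck : Fintype XCheck]
  [fintypeZCheck : Fintype ZCheck]
  Hx : Matrix XCheck Qubit (ZMod 2)
  Hz : Matrix ZCheck Qubit (ZMod 2)
  commute : Hx * Hzᵀ = 0

attribute [instance] CSSCode.fintypeQubit CSSCode.fintypeXCheck CSSCode.fintypeZCheck

namespace CSSCode

variable (C : CSSCode)

/-- The number `n` of physical qubits. -/
def length : ℕ := Fintype.card C.Qubit

/-- The number `k` of logical qubits: `n - k` is the number of independent stabilizer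
generators. -/
noncomputable def dimension : ℕ := C.length - (C.Hx.rank + C.Hz.rank)

/-- The Pauli string with X-part `a` and Z-part `b` (up to a phase) commutes with all the
stabilizers. -/
def IsLogical (a b : C.Qubit → ZMod 2) : Prop := C.Hz *ᵥ a = 0 ∧ C.Hx *ᵥ b = 0

/-- The Pauli string with X-part `a` and Z-part `b` is (up to a phase) a stabilizer, i.e. a trivial
logical operator. -/
def IsTrivialLogical (a b : C.Qubit → ZMod 2) : Prop :=
  (∃ u : C.XCheck → ZMod 2, u ᵥ* C.Hx = a) ∧ (∃ v : C.ZCheck → ZMod 2, v ᵥ* C.Hz = b)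

/-- The number of qubits on which a Pauli string acts nontrivially. -/
def pauliWeight (a b : C.Qubit → ZMod 2) : ℕ := #{q | a q ≠ 0 ∨ b q ≠ 0}

/-- The distance `d`: the minimal weight of a nontrivial logical operator
(`0` if there is none, i.e. if the code has dimension `0`). -/
noncomputable def distance : ℕ :=
  sInf {d | ∃ a b, C.IsLogical a b ∧ ¬ C.IsTrivialLogical a b ∧ C.pauliWeight a b = d}

/-- The maximal weight of the rows and columns of a matrix. -/
def maxWeight {m n : Type} [Fintype m] [Fintype n] (H : Matrix m n (ZMod 2)) : ℕ :=
  max (univ.sup fun i => hammingNorm fun j => H i j) (univ.sup fun j => hammingNorm fun i => H i j)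

/-- The weight `w` of the code: the maximal weight of all rows and columns of `Hx` and `Hz`. -/
def weight : ℕ := max (maxWeight C.Hx) (maxWeight C.Hz)

end CSSCode

section BalancedProduct

/-- The quotient `A × B / G` by the diagonal action. -/
abbrev BalancedVertex (G A B : Type) [Group G] [MulAction G A] [MulAction G B] : Type :=
  MulAction.orbitRel.Quotient G (A × B)

/-- The class of `(a, b)` in `A × B / G`. -/
abbrev BalancedVertex.mk (G : Type) {A B : Type} [Group G] [MulAction G A] [MulAction G B]
    (a : A) (b : B) : BalancedVertex G A B :=
  Quotient.mk (MulAction.orbitRel G (A × B)) (a, b)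

variable {G : Type} [Group G]

/-- For a graph `E` between `A₀` and `A₁`, the edges between `A₀ × B / G` and `A₁ × B / G`. -/
def verticalEdge {A₀ A₁ : Type} (B : Type) [MulAction G A₀] [MulAction G A₁] [MulAction G B]
    (E : A₀ → A₁ → Prop) (z₀ : BalancedVertex G A₀ B) (z₁ : BalancedVertex G A₁ B) : Prop :=
  ∃ a₀ a₁ b, E a₀ a₁ ∧ z₀ = .mk G a₀ b ∧ z₁ = .mk G a₁ b

/-- For a graph `E` between `B₀` and `B₁`, the edges between `A × B₀ / G` and `A × B₁ / G`. -/
def horizontalEdge (A : Type) {B₀ B₁ : Type} [MulAction G A] [MulAction G B₀] [MulAction G B₁]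
    (E : B₀ → B₁ → Prop) (z₀ : BalancedVertex G A B₀) (z₁ : BalancedVertex G A B₁) : Prop :=
  ∃ a b₀ b₁, E b₀ b₁ ∧ z₀ = .mk G a b₀ ∧ z₁ = .mk G a b₁

open Classical in
/-- The adjacency matrix, as the matrix of the map `𝔽₂^A → 𝔽₂^B` that sends the basis vector of `a`
to the sum of the basis vectors of the neighbors of `a`. -/
noncomputable def adjacency {A B : Type} (E : A → B → Prop) : Matrix B A (ZMod 2) :=
  Matrix.of fun b a => if E a b then 1 else 0

noncomputable instance balancedVertexFintype {A B : Type} [Fintype A] [Fintype B] [MulAction G A] [MulAction G B] :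
    Fintype (BalancedVertex G A B) := Fintype.ofFinite _

variable (X Y : FreeBipartiteGraph G)

/-- The map `∂₂ : 𝔽₂^V₀₀ → 𝔽₂^V₁₀ ⊕ 𝔽₂^V₀₁` of the balanced product `X ×_G Y`, where
`V_αβ = X.V_α × Y.V_β / G`. -/
noncomputable def boundary₂ : Matrix (BalancedVertex G X.V₁ Y.V₀ ⊕ BalancedVertex G X.V₀ Y.V₁)
    (BalancedVertex G X.V₀ Y.V₀) (ZMod 2) :=
  Matrix.fromRows (adjacency (verticalEdge Y.V₀ X.E)) (adjacency (horizontalEdge X.V₀ Y.E))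

/-- The map `∂₁ : 𝔽₂^V₁₀ ⊕ 𝔽₂^V₀₁ → 𝔽₂^V₁₁` of the balanced product `X ×_G Y`. -/
noncomputable def boundary₁ : Matrix (BalancedVertex G X.V₁ Y.V₁)
    (BalancedVertex G X.V₁ Y.V₀ ⊕ BalancedVertex G X.V₀ Y.V₁) (ZMod 2) :=
  Matrix.fromCols (adjacency (horizontalEdge X.V₁ Y.E)) (adjacency (verticalEdge Y.V₁ X.E))

theorem verticalEdge_mk_iff {B : Type} [MulAction G B] (x₀ : X.V₀) (b : B)
    (z : BalancedVertex G X.V₁ B) :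
    verticalEdge B X.E (.mk G x₀ b) z ↔ ∃ x₁, X.E x₀ x₁ ∧ .mk G x₁ b = z := by
  constructor
  · rintro ⟨a₀, a₁, b', h, h0, rfl⟩
    obtain ⟨g, hg⟩ := Quotient.exact h0
    simp only [Prod.smul_mk, Prod.mk.injEq] at hg
    obtain ⟨rfl, rfl⟩ := hg
    exact ⟨g • a₁, X.E_smul g _ _ h, Quotient.sound ⟨g, rfl⟩⟩
  · rintro ⟨x₁, h, rfl⟩
    exact ⟨x₀, x₁, b, h, rfl, rfl⟩

theorem horizontalEdge_mk_iff {A : Type} [MulAction G A] (a : A) (y₀ : Y.V₀)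
    (z : BalancedVertex G A Y.V₁) :
    horizontalEdge A Y.E (.mk G a y₀) z ↔ ∃ y₁, Y.E y₀ y₁ ∧ .mk G a y₁ = z := by
  constructor
  · rintro ⟨a', b₀, b₁, h, h0, rfl⟩
    obtain ⟨g, hg⟩ := Quotient.exact h0
    simp only [Prod.smul_mk, Prod.mk.injEq] at hg
    obtain ⟨rfl, rfl⟩ := hg
    exact ⟨g • b₁, Y.E_smul g _ _ h, Quotient.sound ⟨g, rfl⟩⟩
  · rintro ⟨y₁, h, rfl⟩
    exact ⟨a, y₀, y₁, h, rfl, rfl⟩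

open Classical in
theorem sum_verticalEdge {B : Type} [Fintype B] [MulAction G B]
    (hB : ∀ (g : G) (b : B), g • b = b → g = 1) (x₀ : X.V₀) (b : B)
    (f : BalancedVertex G X.V₁ B → ZMod 2) :
    ∑ z, f z * (if verticalEdge B X.E (.mk G x₀ b) z then 1 else 0) =
      ∑ x₁ with X.E x₀ x₁, f (.mk G x₁ b) := by
  simp only [mul_ite, mul_one, mul_zero, ← Finset.sum_filter]
  symm
  refine Finset.sum_bij (fun x₁ _ => .mk G x₁ b) ?_ ?_ ?_ ?_
  · intro x₁ h
    simp only [Finset.mem_filter, Finset.mem_univ, true_and] at h ⊢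
    exact ⟨x₀, x₁, b, h, rfl, rfl⟩
  · intro x₁ _ x₁' _ h
    obtain ⟨g, hg⟩ := Quotient.exact h
    simp only [Prod.smul_mk, Prod.mk.injEq] at hg
    rw [hB g b hg.2, one_smul] at hg
    exact hg.1.symm
  · intro z hz
    simp only [Finset.mem_filter, Finset.mem_univ, true_and] at hz
    obtain ⟨x₁, h, rfl⟩ := (verticalEdge_mk_iff X x₀ b z).1 hz
    exact ⟨x₁, by simpa using h, rfl⟩
  · intros; rfl

open Classical in
theorem sum_horizontalEdge {A : Type} [Fintype A] [MulAction G A]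
    (hA : ∀ (g : G) (a : A), g • a = a → g = 1) (a : A) (y₀ : Y.V₀)
    (f : BalancedVertex G A Y.V₁ → ZMod 2) :
    ∑ z, f z * (if horizontalEdge A Y.E (.mk G a y₀) z then 1 else 0) =
      ∑ y₁ with Y.E y₀ y₁, f (.mk G a y₁) := by
  simp only [mul_ite, mul_one, mul_zero, ← Finset.sum_filter]
  symm
  refine Finset.sum_bij (fun y₁ _ => .mk G a y₁) ?_ ?_ ?_ ?_
  · intro y₁ h
    simp only [Finset.mem_filter, Finset.mem_univ, true_and] at h ⊢
    exact ⟨a, y₀, y₁, h, rfl, rfl⟩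
  · intro y₁ _ y₁' _ h
    obtain ⟨g, hg⟩ := Quotient.exact h
    simp only [Prod.smul_mk, Prod.mk.injEq] at hg
    have h2 := hg.2
    rw [hA g a hg.1, one_smul] at h2
    exact h2.symm
  · intro z hz
    simp only [Finset.mem_filter, Finset.mem_univ, true_and] at hz
    obtain ⟨y₁, h, rfl⟩ := (horizontalEdge_mk_iff Y a y₀ z).1 hz
    exact ⟨y₁, by simpa using h, rfl⟩
  · intros; rfl

/-- The maps `∂₂`, `∂₁` form a chain complex. -/
theorem boundary₁_mul_boundary₂ : boundary₁ X Y * boundary₂ X Y = 0 := by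
  classical
  rw [boundary₁, boundary₂, Matrix.fromCols_mul_fromRows]
  ext z₁₁ z₀₀
  obtain ⟨⟨x₀, y₀⟩, rfl⟩ := Quotient.exists_rep z₀₀
  have h1 := sum_verticalEdge X Y.free₀ x₀ y₀
    fun z => adjacency (horizontalEdge X.V₁ Y.E) z₁₁ z
  have h2 := sum_horizontalEdge Y X.free₀ x₀ y₀
    fun z => adjacency (verticalEdge Y.V₁ X.E) z₁₁ z
  have h3 : ∀ x₁, adjacency (horizontalEdge X.V₁ Y.E) z₁₁ (.mk G x₁ y₀) =
      ∑ y₁ with Y.E y₀ y₁, if z₁₁ = .mk G x₁ y₁ then 1 else 0 := by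
    intro x₁
    rw [← sum_horizontalEdge Y X.free₁ x₁ y₀ fun z => if z₁₁ = z then 1 else 0]
    simp only [adjacency, Matrix.of_apply, ite_mul, one_mul, zero_mul, Finset.sum_ite_eq,
      Finset.mem_univ, if_true]
  have h4 : ∀ y₁, adjacency (verticalEdge Y.V₁ X.E) z₁₁ (.mk G x₀ y₁) =
      ∑ x₁ with X.E x₀ x₁, if z₁₁ = .mk G x₁ y₁ then 1 else 0 := by
    intro y₁
    rw [← sum_verticalEdge X Y.free₁ x₀ y₁ fun z => if z₁₁ = z then 1 else 0]
    simp only [adjacency, Matrix.of_apply, ite_mul, one_mul, zero_mul, Finset.sum_ite_eq,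
      Finset.mem_univ, if_true]
  simp only [h3] at h1
  simp only [h4] at h2
  rw [Finset.sum_comm] at h2
  rw [Matrix.add_apply, Matrix.mul_apply, Matrix.mul_apply]
  have h := (congrArg₂ (· + ·) h1 h2).trans (CharTwo.add_self_eq_zero _)
  exact h

/-- The CSS code of the balanced product `X ×_G Y`: the vertices in `V₀₀`, in `V₁₀` and `V₀₁`, and
in `V₁₁` are the Z-stabilizers, the qubits, and the X-stabilizers. -/
noncomputable def balancedProductCode : CSSCode where
  Qubit := BalancedVertex G X.V₁ Y.V₀ ⊕ BalancedVertex G X.V₀ Y.V₁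
  XCheck := BalancedVertex G X.V₁ Y.V₁
  ZCheck := BalancedVertex G X.V₀ Y.V₀
  Hx := boundary₁ X Y
  Hz := (boundary₂ X Y)ᵀ
  commute := by rw [Matrix.transpose_transpose]; exact boundary₁_mul_boundary₂ X Y

end BalancedProduct

/-!
Minimize a cycle on the qubits of `X ×_G Y` within its homology class, weighting every qubit by the
number of its edges to `V₁₁`. A vertex of `V₁₁` sees an even number of qubits of the cycle, and by
lossless expansion of the disjoint copies of `X` and `Y` of which the product consists, few of the
edges to `V₁₁` share their end with another edge of the same direction; so most edges end in a
vertex that has both a vertical and a horizontal neighbor in the cycle. These two neighbors and the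
vertex span a square with a unique corner in `V₀₀`, so `V₀₀` carries many squares. But minimality
bounds the number of qubits of the cycle around a vertex of `V₀₀`, and the vertices of `V₀₀` that
come close to this bound form a set so small that it expands losslessly, hence they cannot carry
that many squares. So a minimal cycle of weight less than a small constant times `|G|` is zero.
Exchanging the two sides of both graphs gives the same for the other type of logical operators.

The rate is a count of vertices, and it is close to `1` if both graphs are sufficiently unbalanced,
`X` towards `V₁` and `Y` towards `V₀`.
-/

section Degree

variable {A B : Type}

open Classical in
/-- The number of neighbors of `a` in `T`. On the other side of the graph, `degreeIn (flip E) S b`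
is the number of neighbors of `b` in `S`. -/
noncomputable def degreeIn (E : A → B → Prop) (T : Finset B) (a : A) : ℕ := #{b ∈ T | E a b}

theorem sum_degreeIn_comm (E : A → B → Prop) (S : Finset A) (T : Finset B) :
    ∑ a ∈ S, degreeIn E T a = ∑ b ∈ T, degreeIn (flip E) S b := by
  classical exact sum_card_bipartiteAbove_eq_sum_card_bipartiteBelow E

variable [Fintype B]

theorem mem_neighbors_iff {E : A → B → Prop} {S : Finset A} {b : B} :
    b ∈ neighbors E S ↔ ∃ a ∈ S, E a b := by
  simp [neighbors]

theorem mem_neighbors_iff_degreeIn_pos {E : A → B → Prop} {S : Finset A} {b : B} :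
    b ∈ neighbors E S ↔ 0 < degreeIn (flip E) S b := by
  classical exact mem_neighbors_iff.trans (filter_nonempty_iff.symm.trans Finset.card_pos.symm)

theorem sum_degreeIn_add_card_neighbors_le (E : A → B → Prop) (S : Finset A) (D : Finset B) :
    ∑ a ∈ S, degreeIn E D a + #(neighbors E S) ≤ #D + ∑ a ∈ S, degreeIn E univ a := by
  classical
  have outside : #(neighbors E S \ D) ≤ ∑ b ∈ Dᶜ, degreeIn (flip E) S b := by
    rw [card_eq_sum_ones]
    refine (sum_le_sum fun b hb => ?_).trans
      (sum_le_sum_of_subset fun b hb => mem_compl.2 (mem_sdiff.1 hb).2)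
    exact mem_neighbors_iff_degreeIn_pos.1 (mem_sdiff.1 hb).1
  have split : #(neighbors E S) ≤ #(neighbors E S \ D) + #D := card_le_card_sdiff_add_card
  rw [sum_degreeIn_comm, sum_degreeIn_comm E S univ, ← sum_add_sum_compl D]
  lia

theorem two_mul_card_union_neighbors_le {A' : Type} [DecidableEq B] (E : A → B → Prop)
    (F : A' → B → Prop) {S : Finset A} {T : Finset A'}
    (heven : ∀ b, Even (degreeIn (flip E) S b + degreeIn (flip F) T b)) :
    2 * #(neighbors E S ∪ neighbors F T) ≤
      ∑ a ∈ S, degreeIn E univ a + ∑ a ∈ T, degreeIn F univ a := by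
  have two_le : ∀ b ∈ neighbors E S ∪ neighbors F T,
      2 ≤ degreeIn (flip E) S b + degreeIn (flip F) T b := by
    intro b hb
    rw [mem_union, mem_neighbors_iff_degreeIn_pos, mem_neighbors_iff_degreeIn_pos] at hb
    obtain ⟨k, hk⟩ := heven b
    lia
  calc 2 * #(neighbors E S ∪ neighbors F T)
      ≤ ∑ b ∈ neighbors E S ∪ neighbors F T, (degreeIn (flip E) S b + degreeIn (flip F) T b) := by
        rw [mul_comm, ← smul_eq_mul]
        exact card_nsmul_le_sum _ _ _ two_le
    _ ≤ ∑ b, (degreeIn (flip E) S b + degreeIn (flip F) T b) :=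
        sum_le_sum_of_subset (subset_univ _)
    _ = _ := by rw [sum_add_distrib, sum_degreeIn_comm E, sum_degreeIn_comm F]

end Degree

section Biregular

variable {A B : Type} [Fintype A] [Fintype B] {E : A → B → Prop} {w₀ w₁ : ℕ}

namespace IsBiregular

theorem degreeIn_univ (h : IsBiregular E w₀ w₁) (a : A) : degreeIn E univ a = w₀ := h.1 a

theorem flip (h : IsBiregular E w₀ w₁) : IsBiregular (flip E) w₁ w₀ := ⟨h.2, h.1⟩

theorem sum_degreeIn_univ (h : IsBiregular E w₀ w₁) (S : Finset A) :
    ∑ a ∈ S, degreeIn E univ a = w₀ * #S := by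
  rw [sum_congr rfl fun a _ => h.degreeIn_univ a, sum_const, smul_eq_mul, mul_comm]

theorem sum_degreeIn (h : IsBiregular E w₀ w₁) (T : Finset B) :
    ∑ a, degreeIn E T a = w₁ * #T := by
  rw [sum_degreeIn_comm, h.flip.sum_degreeIn_univ]

theorem mul_card_le_of_forall_le (h : IsBiregular E w₀ w₁) {c K : ℝ} (hK : 0 ≤ K) {Z : Finset A}
    {T : Finset B} (hZ : ∀ z ∈ Z, c ≤ K * degreeIn E T z) : c * #Z ≤ K * (w₁ * #T) :=
  calc c * #Z = #Z • c := by rw [nsmul_eq_mul, mul_comm]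
    _ ≤ ∑ z ∈ Z, K * degreeIn E T z := card_nsmul_le_sum _ _ _ hZ
    _ ≤ ∑ z, K * degreeIn E T z :=
      sum_le_sum_of_subset_of_nonneg (subset_univ _) fun _ _ _ => by positivity
    _ = K * (w₁ * #T) := by rw [← mul_sum, ← Nat.cast_sum, h.sum_degreeIn, Nat.cast_mul]

theorem card_mul_eq (h : IsBiregular E w₀ w₁) :
    w₀ * Fintype.card A = w₁ * Fintype.card B := by
  rw [← card_univ, ← card_univ, ← h.sum_degreeIn_univ, h.sum_degreeIn]

end IsBiregular

end Biregular

/-- A `(w₀, w₁)`-regular bipartite graph in which every set of fewer than `m` vertices of `A`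
expands losslessly. Unlike in `IsLosslessExpander`, the threshold `m` is absolute, so that this
property passes to disjoint unions, and only one direction is required. -/
structure ExpandsLosslessly {A B : Type} [Fintype A] [Fintype B] (E : A → B → Prop) (w₀ w₁ : ℕ)
    (m ε : ℝ) : Prop where
  isBiregular : IsBiregular E w₀ w₁
  le_card_neighbors : ∀ S : Finset A, #S < m → (1 - ε) * w₀ * #S ≤ #(neighbors E S)

section LocallyMinimal

variable {A B C : Type} [Fintype A] [Fintype B] [Fintype C]

theorem IsLosslessExpander.expandsLosslessly {E : A → B → Prop} {w₀ w₁ : ℕ} {c ε m : ℝ}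
    (h : IsLosslessExpander E w₀ w₁ c ε) (hm : m ≤ c * Fintype.card A) :
    ExpandsLosslessly E w₀ w₁ m ε :=
  ⟨h.1, fun S hS => h.2.1 S (hS.trans_le hm)⟩

theorem IsLosslessExpander.flip {E : A → B → Prop} {w₀ w₁ : ℕ} {c ε : ℝ}
    (h : IsLosslessExpander E w₀ w₁ c ε) : IsLosslessExpander (flip E) w₁ w₀ c ε :=
  ⟨h.1.flip, h.2.2, h.2.1⟩

/-- Most edges of two sets with lossless expansion end in common neighbors: by parity, an end of an
edge that is not a common neighbor is hit at least twice by the same set. -/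
theorem ExpandsLosslessly.edges_le_two_mul_card_inter_neighbors [DecidableEq C] {E : A → C → Prop}
    {F : B → C → Prop} {wE wE' wF wF' : ℕ} {m ε ε' : ℝ} (hE : ExpandsLosslessly E wE wE' m ε)
    (hF : ExpandsLosslessly F wF wF' m ε') {S : Finset A} {T : Finset B} (hS : #S < m)
    (hT : #T < m) (heven : ∀ c, Even (degreeIn (flip E) S c + degreeIn (flip F) T c)) :
    (wE * #S + wF * #T : ℝ) ≤
      2 * #(neighbors E S ∩ neighbors F T) + 2 * (ε * (wE * #S) + ε' * (wF * #T)) := by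
  have union : (2 * #(neighbors E S ∪ neighbors F T) : ℝ) ≤ wE * #S + wF * #T := by
    have h := two_mul_card_union_neighbors_le E F heven
    rw [hE.isBiregular.sum_degreeIn_univ, hF.isBiregular.sum_degreeIn_univ] at h
    exact_mod_cast h
  have union_inter : (#(neighbors E S ∪ neighbors F T) + #(neighbors E S ∩ neighbors F T) : ℝ) =
      #(neighbors E S) + #(neighbors F T) := by
    exact_mod_cast card_union_add_card_inter _ _
  linarith [hE.le_card_neighbors S hS, hF.le_card_neighbors T hT]

theorem ExpandsLosslessly.sum_degreeIn_le_of_forall_le {E : A → B → Prop} {w₀ w₁ : ℕ} {m ε K : ℝ}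
    (hE : ExpandsLosslessly E w₀ w₁ m ε) (hε : 0 ≤ ε) (hK : ε * K ≤ 1 / 6) {Z : Finset A}
    {T : Finset B} (hZm : #Z < m) (hZ : ∀ z ∈ Z, (w₀ : ℝ) ≤ K * degreeIn E T z) :
    ∑ z ∈ Z, (degreeIn E T z : ℝ) ≤ 6 / 5 * #T := by
  have excess : (∑ z ∈ Z, (degreeIn E T z : ℝ) + #(neighbors E Z) : ℝ) ≤ #T + w₀ * #Z := by
    have h := sum_degreeIn_add_card_neighbors_le E Z T
    rw [hE.isBiregular.sum_degreeIn_univ] at h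
    exact_mod_cast h
  have card_le : (w₀ * #Z : ℝ) ≤ K * ∑ z ∈ Z, (degreeIn E T z : ℝ) := by
    rw [mul_sum, mul_comm, ← nsmul_eq_mul]
    exact card_nsmul_le_sum _ _ _ hZ
  have h₁ : ε * (w₀ * #Z) ≤ 1 / 6 * ∑ z ∈ Z, (degreeIn E T z : ℝ) :=
    calc ε * (w₀ * #Z) ≤ ε * (K * ∑ z ∈ Z, (degreeIn E T z : ℝ)) := by gcongr
      _ = ε * K * ∑ z ∈ Z, (degreeIn E T z : ℝ) := by ring
      _ ≤ 1 / 6 * ∑ z ∈ Z, (degreeIn E T z : ℝ) := by gcongr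
  linarith [hE.le_card_neighbors Z hZm]

theorem mul_le_quarter_add {R D a b : ℝ} (hR : 0 < R) (hD : 0 < D) (ha : 0 ≤ a) (hb : 0 ≤ b)
    (h : R * a + D * b ≤ D * R) : a * b ≤ (R * a + D * b) / 4 := by
  have hsum : 0 ≤ R * a + D * b := by positivity
  refine le_of_mul_le_mul_left ?_ (mul_pos hD hR)
  nlinarith [sq_nonneg (R * a - D * b), mul_le_mul_of_nonneg_left h hsum]

open Classical in
theorem mul_le_light_add_heavy {R D U a b : ℝ} (hR : 0 < R) (hD : 0 < D) (hU : 0 < U) (ha : 0 ≤ a)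
    (hb : 0 ≤ b) (h : R * a + D * b ≤ D * R) :
    a * b ≤ R / (12 * U) * a + (if R ≤ 12 * U * b then D / 12 * b else 0) +
      (if R ≤ 12 * U * b ∧ D ≤ 12 * a then (R * a + D * b) / 4 else 0) := by
  have light : 0 ≤ R / (12 * U) * a := by positivity
  by_cases hb' : R ≤ 12 * U * b
  · by_cases ha' : D ≤ 12 * a
    · rw [if_pos hb', if_pos ⟨hb', ha'⟩]
      have : 0 ≤ D / 12 * b := by positivity
      linarith [mul_le_quarter_add hR hD ha hb h]
    · rw [if_pos hb', if_neg fun h => ha' h.2]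
      nlinarith
  · rw [if_neg hb', if_neg fun h => hb' h.1, add_zero, add_zero, mul_comm]
    gcongr
    rw [le_div_iff₀ (by positivity)]
    linarith

/-- The product is large only at vertices with many neighbors in `T` and in `S`; these form a small
set, whose expansion bounds the number of edges into `S` and `T`. The threshold for `T` is scaled by
`wU` because `εV`, unlike `εH`, need not be small compared to `wU`. -/
theorem sum_degreeIn_mul_degreeIn_le {v : A → B → Prop} {h : A → C → Prop} {wD wU wR wL : ℕ}
    {εV εH m : ℝ} (hv : ExpandsLosslessly v wD wU m εV) (hh : ExpandsLosslessly h wR wL m εH)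
    (hD : 0 < wD) (hU : 0 < wU) (hR : 0 < wR) (hεV : 0 ≤ εV) (hεV' : εV ≤ 1 / 72)
    (hεH : 0 ≤ εH) (hεH' : εH * wU ≤ 1 / 72) {S : Finset B} {T : Finset C}
    (hmin : ∀ z, wR * degreeIn v S z + wD * degreeIn h T z ≤ wD * wR)
    (hT : 12 * wU * wL * #T < m) :
    ∑ z, (degreeIn v S z * degreeIn h T z : ℝ) ≤ 2 / 5 * (wR * #S + wD * #T) := by
  classical
  let Z : Finset A := {z | (wR : ℝ) ≤ 12 * wU * degreeIn h T z}
  let Z' : Finset A := {z | (wR : ℝ) ≤ 12 * wU * degreeIn h T z ∧ (wD : ℝ) ≤ 12 * degreeIn v S z}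
  have hZ'Z : Z' ⊆ Z := monotone_filter_right _ fun _ _ hz => hz.1
  have hZm : #Z < m :=
    calc (#Z : ℝ) ≤ wR * #Z :=
          le_mul_of_one_le_left (Nat.cast_nonneg _) (by exact_mod_cast hR)
      _ ≤ 12 * wU * (wL * #T) := hh.isBiregular.mul_card_le_of_forall_le (by positivity)
          fun z hz => (mem_filter.1 hz).2
      _ < m := by linarith
  have hZ'm : #Z' < m := lt_of_le_of_lt (by exact_mod_cast card_le_card hZ'Z) hZm
  have sum_Z : ∑ z ∈ Z, (degreeIn h T z : ℝ) ≤ 6 / 5 * #T :=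
    hh.sum_degreeIn_le_of_forall_le hεH (by linarith) hZm fun z hz => (mem_filter.1 hz).2
  have sum_Z'_T : ∑ z ∈ Z', (degreeIn h T z : ℝ) ≤ 6 / 5 * #T :=
    (sum_le_sum_of_subset_of_nonneg hZ'Z fun _ _ _ => Nat.cast_nonneg _).trans sum_Z
  have sum_Z'_S : ∑ z ∈ Z', (degreeIn v S z : ℝ) ≤ 6 / 5 * #S :=
    hv.sum_degreeIn_le_of_forall_le hεV (by linarith) hZ'm fun z hz => (mem_filter.1 hz).2.2
  have sum_univ : ∑ z, (degreeIn v S z : ℝ) = wU * #S := by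
    exact_mod_cast hv.isBiregular.sum_degreeIn S
  calc ∑ z, (degreeIn v S z * degreeIn h T z : ℝ)
      ≤ wR / (12 * wU) * ∑ z, (degreeIn v S z : ℝ) + wD / 12 * ∑ z ∈ Z, (degreeIn h T z : ℝ) +
          (wR * ∑ z ∈ Z', (degreeIn v S z : ℝ) + wD * ∑ z ∈ Z', (degreeIn h T z : ℝ)) / 4 := by
        refine (sum_le_sum fun z _ => mul_le_light_add_heavy (R := wR) (D := wD) (U := wU)
          (by positivity) (by positivity) (by positivity) (by positivity) (by positivity)
          (by exact_mod_cast hmin z)).trans_eq ?_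
        simp only [Z, Z', sum_add_distrib, ← sum_filter, ← mul_sum, ← sum_div]
    _ ≤ wR / (12 * wU) * (wU * #S) + wD / 12 * (6 / 5 * #T) +
          (wR * (6 / 5 * #S) + wD * (6 / 5 * #T)) / 4 := by
        rw [sum_univ]; gcongr
    _ = (1 / 12 + 3 / 10) * (wR * #S) + 2 / 5 * (wD * #T) := by field_simp; ring
    _ ≤ 2 / 5 * (wR * #S + wD * #T) := by linarith [show (0 : ℝ) ≤ wR * #S by positivity]

end LocallyMinimal

section DisjointCopies

variable {B₀ B₁ V₀ V₁ : Type} {E : B₀ → B₁ → Prop} {R : V₀ → V₁ → Prop}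

/-- `R` is isomorphic to a disjoint union of finitely many copies of `E`, indexed by `O`. -/
def IsDisjointCopies (E : B₀ → B₁ → Prop) (R : V₀ → V₁ → Prop) : Prop :=
  ∃ (O : Type) (_ : Finite O) (e₀ : O × B₀ ≃ V₀) (e₁ : O × B₁ ≃ V₁),
    ∀ o b o' b', R (e₀ (o, b)) (e₁ (o', b')) ↔ o = o' ∧ E b b'

open Classical in
theorem card_eq_sum_card_fiber {O B V : Type} [Fintype O] [Fintype B] (e : O × B ≃ V)
    (S : Finset V) : #S = ∑ o, #{b | e (o, b) ∈ S} := by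
  have : Fintype V := Fintype.ofEquiv _ e
  calc #S = ∑ v, if v ∈ S then 1 else 0 := by rw [← card_filter, filter_univ_mem]
    _ = ∑ o, ∑ b, if e (o, b) ∈ S then 1 else 0 := by
      rw [← e.sum_comp, Fintype.sum_prod_type]
    _ = ∑ o, #{b | e (o, b) ∈ S} := by simp only [card_filter]

namespace IsDisjointCopies

theorem flip (h : IsDisjointCopies E R) : IsDisjointCopies (flip E) (flip R) := by
  obtain ⟨O, hO, e₀, e₁, hR⟩ := h
  exact ⟨O, hO, e₁, e₀, fun o b o' b' => (hR o' b' o b).trans (and_congr_left' eq_comm)⟩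

variable [Fintype B₁] [Fintype V₁]

theorem degreeIn_univ_eq (h : IsDisjointCopies E R) {w : ℕ} (hE : ∀ b, degreeIn E univ b = w)
    (v : V₀) : degreeIn R univ v = w := by
  classical
  obtain ⟨O, hO, e₀, e₁, hR⟩ := h
  have := Fintype.ofFinite O
  obtain ⟨⟨o, b⟩, rfl⟩ := e₀.surjective v
  rw [← hE b, degreeIn, degreeIn, card_filter, card_filter, ← e₁.sum_comp, Fintype.sum_prod_type]
  simp only [hR, ite_and, sum_ite_irrel, sum_const_zero, sum_ite_eq, mem_univ, if_true]

variable [Fintype B₀] [Fintype V₀]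

theorem isBiregular (h : IsDisjointCopies E R) {w₀ w₁ : ℕ} (hE : IsBiregular E w₀ w₁) :
    IsBiregular R w₀ w₁ :=
  ⟨h.degreeIn_univ_eq hE.1, h.flip.degreeIn_univ_eq hE.2⟩

theorem expandsLosslessly (h : IsDisjointCopies E R) {w₀ w₁ : ℕ} {m ε : ℝ}
    (hE : ExpandsLosslessly E w₀ w₁ m ε) : ExpandsLosslessly R w₀ w₁ m ε := by
  classical
  refine ⟨h.isBiregular hE.isBiregular, fun S hS => ?_⟩
  obtain ⟨O, hO, e₀, e₁, hR⟩ := h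
  have := Fintype.ofFinite O
  have fiber_neighbors (o) : neighbors E {b | e₀ (o, b) ∈ S} ⊆
      ({b' | e₁ (o, b') ∈ neighbors R S} : Finset B₁) := by
    intro b' hb'
    obtain ⟨b, hb, hbb'⟩ := mem_neighbors_iff.1 hb'
    rw [mem_filter_univ] at hb ⊢
    exact mem_neighbors_iff.2 ⟨e₀ (o, b), hb, (hR _ _ _ _).2 ⟨rfl, hbb'⟩⟩
  have fiber_small (o) : (#{b | e₀ (o, b) ∈ S} : ℝ) < m := by
    refine lt_of_le_of_lt ?_ hS
    rw [card_eq_sum_card_fiber e₀ S]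
    exact_mod_cast single_le_sum (f := fun o => #{b | e₀ (o, b) ∈ S})
      (fun _ _ => Nat.zero_le _) (mem_univ o)
  rw [card_eq_sum_card_fiber e₀ S, card_eq_sum_card_fiber e₁ (neighbors R S)]
  push_cast
  rw [mul_sum]
  refine sum_le_sum fun o _ => (hE.le_card_neighbors _ (fiber_small o)).trans ?_
  exact_mod_cast card_le_card (fiber_neighbors o)

end IsDisjointCopies

end DisjointCopies

section BalancedVertex

variable {G : Type} [Group G]

instance FreeBipartiteGraph.isCancelSMul₀ (X : FreeBipartiteGraph G) : IsCancelSMul G X.V₀ :=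
  isCancelSMul_iff_eq_one_of_smul_eq.2 X.free₀

instance FreeBipartiteGraph.isCancelSMul₁ (X : FreeBipartiteGraph G) : IsCancelSMul G X.V₁ :=
  isCancelSMul_iff_eq_one_of_smul_eq.2 X.free₁

namespace BalancedVertex

variable {A B : Type} [MulAction G A] [MulAction G B]

theorem mk_eq_mk {a a' : A} {b b' : B} :
    mk G a b = mk G a' b' ↔ ∃ g : G, g • a' = a ∧ g • b' = b := by
  rw [Quotient.eq, MulAction.orbitRel_apply, MulAction.mem_orbit_iff]
  simp only [Prod.smul_mk, Prod.mk.injEq]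

theorem mk_smul (g : G) (a : A) (b : B) : mk G (g • a) (g • b) = mk G a b :=
  mk_eq_mk.2 ⟨g, rfl, rfl⟩

theorem mk_right_injective [IsCancelSMul G A] (a : A) :
    Function.Injective (mk G a : B → BalancedVertex G A B) := by
  intro b b' h
  obtain ⟨g, hg, rfl⟩ := mk_eq_mk.1 h
  rw [IsCancelSMul.eq_one_of_smul hg, one_smul]

theorem mk_left_injective [IsCancelSMul G B] (b : B) :
    Function.Injective fun a : A => mk G a b := by
  intro a a' h
  obtain ⟨g, rfl, hg⟩ := mk_eq_mk.1 h
  rw [IsCancelSMul.eq_one_of_smul hg, one_smul]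

theorem card_mul_card [Fintype G] [Fintype A] [Fintype B] [IsCancelSMul G A] :
    Fintype.card (BalancedVertex G A B) * Fintype.card G = Fintype.card A * Fintype.card B := by
  have : IsCancelSMul G (A × B) := isCancelSMul_iff_eq_one_of_smul_eq.2 fun g x h =>
    IsCancelSMul.eq_one_of_smul (congrArg Prod.fst h)
  rw [← Fintype.card_prod, ← Fintype.card_prod]
  exact (Fintype.card_congr (MulAction.selfEquivOrbitsQuotientProd
    (IsCancelSMul.stabilizer_eq_bot (G := G) (α := A × B)))).symm

variable (G A B) in
/-- The bijection `(a, b) ↦ (b, a)` between the two balanced products of `A` and `B`, which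
exchanges horizontal and vertical edges. -/
def comm : BalancedVertex G A B ≃ BalancedVertex G B A :=
  Quotient.congr (Equiv.prodComm A B) fun x y => by
    simp only [MulAction.orbitRel_apply, MulAction.mem_orbit_iff, Prod.ext_iff, and_comm]
    rfl

variable (G A B) in
/-- If `G` acts freely on `A`, then `A × B / G` consists of one copy of `B` for every orbit of `A`:
the orbit `o` and `b` are sent to the class of `(o.out, b)`. -/
noncomputable def orbitProdEquiv [IsCancelSMul G A] :
    MulAction.orbitRel.Quotient G A × B ≃ BalancedVertex G A B :=
  Equiv.ofBijective (fun t => mk G t.1.out t.2) <| by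
    constructor
    · rintro ⟨o, b⟩ ⟨o', b'⟩ h
      obtain ⟨g, hg, -⟩ := mk_eq_mk.1 h
      obtain rfl : o = o' := by
        rw [← o.out_eq, ← o'.out_eq]
        exact Quotient.sound ⟨g, hg⟩
      exact Prod.ext rfl (mk_right_injective _ h)
    · intro z
      obtain ⟨⟨a, b⟩, rfl⟩ := Quotient.exists_rep z
      let o : MulAction.orbitRel.Quotient G A := Quotient.mk _ a
      obtain ⟨g, hg⟩ : ∃ g : G, g • a = o.out := Quotient.exact o.out_eq
      exact ⟨(o, g • b), mk_eq_mk.2 ⟨g, hg, rfl⟩⟩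

end BalancedVertex

open BalancedVertex

variable {A : Type} [MulAction G A]

theorem isDisjointCopies_horizontalEdge [Finite A] [IsCancelSMul G A] (Y : FreeBipartiteGraph G) :
    IsDisjointCopies Y.E (horizontalEdge (G := G) A Y.E) := by
  refine ⟨MulAction.orbitRel.Quotient G A, inferInstance, orbitProdEquiv G A Y.V₀,
    orbitProdEquiv G A Y.V₁, fun o y₀ o' y₁ => (horizontalEdge_mk_iff Y _ _ _).trans ?_⟩
  change (∃ y, Y.E y₀ y ∧ orbitProdEquiv G A Y.V₁ (o, y) = orbitProdEquiv G A Y.V₁ (o', y₁)) ↔ _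
  simp only [EmbeddingLike.apply_eq_iff_eq, Prod.mk.injEq]
  grind

theorem verticalEdge_iff_horizontalEdge_comm {B₀ B₁ : Type} [MulAction G B₀] [MulAction G B₁]
    {E : B₀ → B₁ → Prop} (z₀ : BalancedVertex G B₀ A) (z₁ : BalancedVertex G B₁ A) :
    verticalEdge A E z₀ z₁ ↔ horizontalEdge A E (comm G B₀ A z₀) (comm G B₁ A z₁) := by
  constructor
  · rintro ⟨b₀, b₁, a, h, rfl, rfl⟩
    exact ⟨a, b₀, b₁, h, rfl, rfl⟩
  · rintro ⟨a, b₀, b₁, h, h₀, h₁⟩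
    exact ⟨b₀, b₁, a, h, (Equiv.eq_symm_apply _).2 h₀, (Equiv.eq_symm_apply _).2 h₁⟩

theorem isDisjointCopies_verticalEdge [Finite A] [IsCancelSMul G A] (X : FreeBipartiteGraph G) :
    IsDisjointCopies X.E (verticalEdge (G := G) A X.E) := by
  obtain ⟨O, hO, e₀, e₁, h⟩ := isDisjointCopies_horizontalEdge (A := A) X
  refine ⟨O, hO, e₀.trans (comm G X.V₀ A).symm, e₁.trans (comm G X.V₁ A).symm,
    fun o b o' b' => ?_⟩
  rw [verticalEdge_iff_horizontalEdge_comm, ← h]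
  simp only [Equiv.trans_apply, Equiv.apply_symm_apply]

/-- The four vertices span a square of the balanced product. -/
def IsBalancedSquare (X Y : FreeBipartiteGraph G) (z : BalancedVertex G X.V₀ Y.V₀)
    (q : BalancedVertex G X.V₁ Y.V₀) (p : BalancedVertex G X.V₀ Y.V₁)
    (v : BalancedVertex G X.V₁ Y.V₁) : Prop :=
  ∃ x₀ x₁ y₀ y₁, z = mk G x₀ y₀ ∧ q = mk G x₁ y₀ ∧ p = mk G x₀ y₁ ∧ v = mk G x₁ y₁

variable {X Y : FreeBipartiteGraph G} {z : BalancedVertex G X.V₀ Y.V₀}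
  {q : BalancedVertex G X.V₁ Y.V₀} {p : BalancedVertex G X.V₀ Y.V₁}
  {v v' : BalancedVertex G X.V₁ Y.V₁}

theorem exists_isBalancedSquare (hq : horizontalEdge X.V₁ Y.E q v)
    (hp : verticalEdge Y.V₁ X.E p v) : ∃ z, verticalEdge Y.V₀ X.E z q ∧
      horizontalEdge X.V₀ Y.E z p ∧ IsBalancedSquare X Y z q p v := by
  obtain ⟨a, y₀, y₁, hE, rfl, rfl⟩ := hq
  obtain ⟨x₀, x₁, b, hE', rfl, h⟩ := hp
  obtain ⟨g, rfl, rfl⟩ := mk_eq_mk.1 h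
  have hp : mk G x₀ b = mk G (g • x₀) (g • b) := (mk_smul g x₀ b).symm
  exact ⟨mk G (g • x₀) y₀, ⟨_, _, _, X.E_smul g _ _ hE', rfl, rfl⟩, ⟨_, _, _, hE, rfl, hp⟩,
    _, _, _, _, rfl, rfl, hp, rfl⟩

theorem IsBalancedSquare.unique (h : IsBalancedSquare X Y z q p v)
    (h' : IsBalancedSquare X Y z q p v') : v = v' := by
  obtain ⟨x₀, x₁, y₀, y₁, rfl, rfl, rfl, rfl⟩ := h
  obtain ⟨a₀, a₁, b₀, b₁, hz, hq, hp, rfl⟩ := h'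
  obtain ⟨g, rfl, rfl⟩ := mk_eq_mk.1 hz
  obtain rfl := mk_left_injective _ (hq.trans (mk_smul g a₁ b₀).symm)
  obtain rfl := mk_right_injective _ (hp.trans (mk_smul g a₀ b₁).symm)
  exact mk_smul g a₁ b₁

theorem card_inter_neighbors_le_sum_mul [DecidableEq (BalancedVertex G X.V₁ Y.V₁)]
    (S : Finset (BalancedVertex G X.V₁ Y.V₀)) (T : Finset (BalancedVertex G X.V₀ Y.V₁)) :
    #(neighbors (horizontalEdge X.V₁ Y.E) S ∩ neighbors (verticalEdge Y.V₁ X.E) T) ≤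
      ∑ z, degreeIn (verticalEdge Y.V₀ X.E) S z * degreeIn (horizontalEdge X.V₀ Y.E) T z := by
  classical
  calc _ ≤ #(univ.sigma fun z =>
        {q ∈ S | verticalEdge Y.V₀ X.E z q} ×ˢ {p ∈ T | horizontalEdge X.V₀ Y.E z p}) := by
        refine card_le_card_of_forall_subsingleton
          (fun v t => IsBalancedSquare X Y t.1 t.2.1 t.2.2 v) (fun v hv => ?_)
          (by rintro ⟨z, q, p⟩ _ v hv v' hv'; exact hv.2.unique hv'.2)
        obtain ⟨⟨q, hqS, hq⟩, p, hpT, hp⟩ :=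
          (mem_inter.1 hv).imp mem_neighbors_iff.1 mem_neighbors_iff.1
        obtain ⟨z, hzq, hzp, hsquare⟩ := exists_isBalancedSquare hq hp
        exact ⟨⟨z, q, p⟩, by simp [hqS, hpT, hzq, hzp], hsquare⟩
    _ = _ := by simp only [card_sigma, card_product, degreeIn]

end BalancedVertex

section Chains

variable {A B : Type}

/-- The support of a chain with coefficients in `𝔽₂`, as a finite set. -/
def supp [Fintype A] (f : A → ZMod 2) : Finset A := {a | f a ≠ 0}

theorem hammingNorm_eq_add [Fintype A] [Fintype B] (f : A ⊕ B → ZMod 2) :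
    hammingNorm f = hammingNorm (f ∘ Sum.inl) + hammingNorm (f ∘ Sum.inr) := by
  simp only [hammingNorm, card_filter, Fintype.sum_sum_type, Function.comp_apply]

theorem adjacency_mulVec_apply [Fintype A] (E : A → B → Prop) (f : A → ZMod 2) (b : B) :
    (adjacency E *ᵥ f) b = degreeIn (flip E) (supp f) b := by
  have zero_or_one : ∀ x : ZMod 2, x = 0 ∨ x = 1 := by decide
  rw [degreeIn, supp, filter_filter, card_filter, Nat.cast_sum]
  refine sum_congr rfl fun a _ => ?_
  by_cases hE : E a b <;> rcases zero_or_one (f a) with h | h <;> simp [adjacency, flip, hE, h]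

theorem hammingNorm_add_col_adjacency [Fintype B] (E : A → B → Prop) (f : B → ZMod 2) (a : A) :
    hammingNorm (f + (adjacency E).col a) + 2 * degreeIn E (supp f) a =
      hammingNorm f + degreeIn E univ a := by
  have zero_or_one : ∀ x : ZMod 2, x = 0 ∨ x = 1 := by decide
  simp only [hammingNorm, degreeIn, supp, filter_filter, card_filter, mul_sum, ← sum_add_distrib]
  refine sum_congr rfl fun b _ => ?_
  by_cases hE : E a b <;> rcases zero_or_one (f b) with h | h <;>
    simp [adjacency, hE, h, CharTwo.add_self_eq_zero]

/-- The number of edges to `V₁₁` from the support of a chain on the qubits, if each vertex of `V₁₀`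
has `wR` and each vertex of `V₀₁` has `wD` such edges. -/
def edgeWeight [Fintype A] [Fintype B] (wR wD : ℕ) (c : A ⊕ B → ZMod 2) : ℕ :=
  wR * hammingNorm (c ∘ Sum.inl) + wD * hammingNorm (c ∘ Sum.inr)

theorem cast_edgeWeight [Fintype A] [Fintype B] (wR wD : ℕ) (c : A ⊕ B → ZMod 2) :
    (edgeWeight wR wD c : ℝ) = wR * #(supp (c ∘ Sum.inl)) + wD * #(supp (c ∘ Sum.inr)) := by
  rw [edgeWeight, Nat.cast_add, Nat.cast_mul, Nat.cast_mul]
  rfl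

theorem edgeWeight_le_mul_hammingNorm [Fintype A] [Fintype B] (wR wD : ℕ) (c : A ⊕ B → ZMod 2) :
    edgeWeight wR wD c ≤ (wD + wR) * hammingNorm c := by
  rw [edgeWeight, hammingNorm_eq_add c]
  nlinarith

theorem hammingNorm_comp_inl_le_edgeWeight [Fintype A] [Fintype B] {wR : ℕ} (hR : 0 < wR) (wD : ℕ)
    (c : A ⊕ B → ZMod 2) : hammingNorm (c ∘ Sum.inl) ≤ edgeWeight wR wD c :=
  (Nat.le_mul_of_pos_left _ hR).trans (Nat.le_add_right _ _)

theorem hammingNorm_comp_inr_le_edgeWeight [Fintype A] [Fintype B] (wR : ℕ) {wD : ℕ} (hD : 0 < wD)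
    (c : A ⊕ B → ZMod 2) : hammingNorm (c ∘ Sum.inr) ≤ edgeWeight wR wD c :=
  (Nat.le_mul_of_pos_left _ hD).trans (Nat.le_add_left _ _)

theorem eq_zero_of_edgeWeight_eq_zero [Fintype A] [Fintype B] {wR wD : ℕ} (hR : 0 < wR)
    (hD : 0 < wD) {c : A ⊕ B → ZMod 2} (h : edgeWeight wR wD c = 0) : c = 0 := by
  obtain ⟨hl, hr⟩ := Nat.add_eq_zero_iff.1 h
  replace hl := hammingNorm_eq_zero.1 ((Nat.mul_eq_zero.1 hl).resolve_left hR.ne')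
  replace hr := hammingNorm_eq_zero.1 ((Nat.mul_eq_zero.1 hr).resolve_left hD.ne')
  rw [← Sum.elim_comp_inl_inr c, hl, hr, Sum.elim_zero_zero]

end Chains

section Homology

variable {G : Type} [Group G] {X Y : FreeBipartiteGraph G}
  {c : BalancedVertex G X.V₁ Y.V₀ ⊕ BalancedVertex G X.V₀ Y.V₁ → ZMod 2}

/-- The hypotheses on `X` and `Y` under which small cycles of `X ×_G Y` are boundaries: both graphs
expand losslessly from `V₀` to `V₁`, and their degrees are as in `IsBiregular X.E wD wU` and
`IsBiregular Y.E wR wL`. -/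
structure ExpandsForward (X Y : FreeBipartiteGraph G) (wD wU wR wL : ℕ) (εV εH m : ℝ) : Prop where
  vertical : ExpandsLosslessly X.E wD wU m εV
  horizontal : ExpandsLosslessly Y.E wR wL m εH
  down_pos : 0 < wD
  up_pos : 0 < wU
  right_pos : 0 < wR
  left_pos : 0 < wL
  εV_nonneg : 0 ≤ εV
  εV_le : εV ≤ 1 / 72
  εH_nonneg : 0 ≤ εH
  εH_mul_le : εH * wU ≤ 1 / 72

variable {wD wU wR wL : ℕ} {εV εH m : ℝ}

/-- The edge weight of the chain does not decrease when the boundary of a single vertex of `V₀₀` is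
added to it. -/
def IsLocallyMinimal (X Y : FreeBipartiteGraph G) (wR wD : ℕ)
    (c : BalancedVertex G X.V₁ Y.V₀ ⊕ BalancedVertex G X.V₀ Y.V₁ → ZMod 2) : Prop :=
  open Classical in ∀ z, edgeWeight wR wD c ≤ edgeWeight wR wD (c + boundary₂ X Y *ᵥ Pi.single z 1)

theorem even_degreeIn_add_degreeIn_of_boundary₁_eq_zero (hc : boundary₁ X Y *ᵥ c = 0)
    (v : BalancedVertex G X.V₁ Y.V₁) :
    Even (degreeIn (flip (horizontalEdge X.V₁ Y.E)) (supp (c ∘ Sum.inl)) v +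
      degreeIn (flip (verticalEdge Y.V₁ X.E)) (supp (c ∘ Sum.inr)) v) := by
  rw [← ZMod.natCast_eq_zero_iff_even, Nat.cast_add, ← adjacency_mulVec_apply,
    ← adjacency_mulVec_apply, ← Pi.add_apply, ← Matrix.fromCols_mulVec]
  exact congrFun hc v

theorem IsLocallyMinimal.mul_degreeIn_add_le (hX : IsBiregular X.E wD wU)
    (hY : IsBiregular Y.E wR wL) (hmin : IsLocallyMinimal X Y wR wD c)
    (z : BalancedVertex G X.V₀ Y.V₀) :
    wR * degreeIn (verticalEdge Y.V₀ X.E) (supp (c ∘ Sum.inl)) z +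
      wD * degreeIn (horizontalEdge X.V₀ Y.E) (supp (c ∘ Sum.inr)) z ≤ wD * wR := by
  classical
  have flip_left := hammingNorm_add_col_adjacency (verticalEdge Y.V₀ X.E) (c ∘ Sum.inl) z
  have flip_right := hammingNorm_add_col_adjacency (horizontalEdge X.V₀ Y.E) (c ∘ Sum.inr) z
  rw [((isDisjointCopies_verticalEdge X).isBiregular hX).degreeIn_univ] at flip_left
  rw [((isDisjointCopies_horizontalEdge Y).isBiregular hY).degreeIn_univ] at flip_right
  have hz : edgeWeight wR wD c ≤
      wR * hammingNorm (c ∘ Sum.inl + (adjacency (verticalEdge Y.V₀ X.E)).col z) +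
        wD * hammingNorm (c ∘ Sum.inr + (adjacency (horizontalEdge X.V₀ Y.E)).col z) := by
    have h := hmin z
    rw [Matrix.mulVec_single_one] at h
    exact h
  rw [edgeWeight] at hz
  nlinarith

namespace ExpandsForward

theorem expandsLosslessly_verticalEdge {A : Type} [Fintype A] [MulAction G A] [IsCancelSMul G A]
    (h : ExpandsForward X Y wD wU wR wL εV εH m) :
    ExpandsLosslessly (verticalEdge (G := G) A X.E) wD wU m εV :=
  (isDisjointCopies_verticalEdge X).expandsLosslessly h.vertical

theorem expandsLosslessly_horizontalEdge {A : Type} [Fintype A] [MulAction G A] [IsCancelSMul G A]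
    (h : ExpandsForward X Y wD wU wR wL εV εH m) :
    ExpandsLosslessly (horizontalEdge (G := G) A Y.E) wR wL m εH :=
  (isDisjointCopies_horizontalEdge Y).expandsLosslessly h.horizontal

theorem edgeWeight_le_card_inter_neighbors [DecidableEq (BalancedVertex G X.V₁ Y.V₁)]
    (h : ExpandsForward X Y wD wU wR wL εV εH m) (hc : boundary₁ X Y *ᵥ c = 0)
    (hm : (edgeWeight wR wD c : ℝ) < m) :
    35 / 36 * (edgeWeight wR wD c : ℝ) ≤ 2 * #(neighbors (horizontalEdge X.V₁ Y.E)
      (supp (c ∘ Sum.inl)) ∩ neighbors (verticalEdge Y.V₁ X.E) (supp (c ∘ Sum.inr))) := by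
  have one_le_U : (1 : ℝ) ≤ wU := by exact_mod_cast h.up_pos
  have hεH : εH ≤ 1 / 72 := (le_mul_of_one_le_right h.εH_nonneg one_le_U).trans h.εH_mul_le
  have edges := h.expandsLosslessly_horizontalEdge.edges_le_two_mul_card_inter_neighbors
    h.expandsLosslessly_verticalEdge
    (lt_of_le_of_lt (mod_cast hammingNorm_comp_inl_le_edgeWeight h.right_pos wD c) hm)
    (lt_of_le_of_lt (mod_cast hammingNorm_comp_inr_le_edgeWeight wR h.down_pos c) hm)
    (even_degreeIn_add_degreeIn_of_boundary₁_eq_zero hc)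
  have error_left : εH * (wR * #(supp (c ∘ Sum.inl))) ≤ 1 / 72 * (wR * #(supp (c ∘ Sum.inl))) := by
    gcongr
  have error_right : εV * (wD * #(supp (c ∘ Sum.inr))) ≤ 1 / 72 * (wD * #(supp (c ∘ Sum.inr))) := by
    gcongr
    exact h.εV_le
  linarith [cast_edgeWeight wR wD c]

theorem card_inter_neighbors_le_edgeWeight [DecidableEq (BalancedVertex G X.V₁ Y.V₁)]
    (h : ExpandsForward X Y wD wU wR wL εV εH m) (hmin : IsLocallyMinimal X Y wR wD c)
    (hm : 12 * wU * wL * (edgeWeight wR wD c : ℝ) < m) :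
    (#(neighbors (horizontalEdge X.V₁ Y.E) (supp (c ∘ Sum.inl)) ∩
      neighbors (verticalEdge Y.V₁ X.E) (supp (c ∘ Sum.inr))) : ℝ) ≤
      2 / 5 * edgeWeight wR wD c := by
  have hT : 12 * wU * wL * (#(supp (c ∘ Sum.inr)) : ℝ) < m := by
    refine lt_of_le_of_lt ?_ hm
    gcongr
    exact hammingNorm_comp_inr_le_edgeWeight wR h.down_pos c
  have squares := sum_degreeIn_mul_degreeIn_le h.expandsLosslessly_verticalEdge
    h.expandsLosslessly_horizontalEdge h.down_pos h.up_pos h.right_pos h.εV_nonneg h.εV_le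
    h.εH_nonneg h.εH_mul_le
    (hmin.mul_degreeIn_add_le h.vertical.isBiregular h.horizontal.isBiregular) hT
  rw [cast_edgeWeight]
  exact le_trans (mod_cast card_inter_neighbors_le_sum_mul _ _) squares

theorem eq_zero_of_isLocallyMinimal (h : ExpandsForward X Y wD wU wR wL εV εH m)
    (hc : boundary₁ X Y *ᵥ c = 0) (hmin : IsLocallyMinimal X Y wR wD c)
    (hm : 12 * wU * wL * (edgeWeight wR wD c : ℝ) < m) : c = 0 := by
  classical
  have weight_lt : (edgeWeight wR wD c : ℝ) < m := by
    have one_le : 1 ≤ 12 * wU * wL := Nat.mul_pos (Nat.mul_pos (by simp) h.up_pos) h.left_pos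
    exact (le_mul_of_one_le_left (Nat.cast_nonneg _) (by exact_mod_cast one_le)).trans_lt hm
  have weight_nonpos : (edgeWeight wR wD c : ℝ) ≤ 0 := by
    linarith [h.edgeWeight_le_card_inter_neighbors hc weight_lt,
      h.card_inter_neighbors_le_edgeWeight hmin hm]
  exact eq_zero_of_edgeWeight_eq_zero h.right_pos h.down_pos
    (Nat.le_zero.1 (by exact_mod_cast weight_nonpos))

theorem exists_boundary₂_mulVec_eq (h : ExpandsForward X Y wD wU wR wL εV εH m)
    (hc : boundary₁ X Y *ᵥ c = 0)
    (hm : 12 * wU * wL * (wD + wR) * (hammingNorm c : ℝ) < m) :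
    ∃ v, boundary₂ X Y *ᵥ v = c := by
  classical
  obtain ⟨v, hv⟩ := Finite.exists_min fun v => edgeWeight wR wD (c + boundary₂ X Y *ᵥ v)
  have cycle : boundary₁ X Y *ᵥ (c + boundary₂ X Y *ᵥ v) = 0 := by
    rw [Matrix.mulVec_add, hc, Matrix.mulVec_mulVec, boundary₁_mul_boundary₂, Matrix.zero_mulVec,
      add_zero]
  have locallyMinimal : IsLocallyMinimal X Y wR wD (c + boundary₂ X Y *ᵥ v) := fun z => by
    rw [add_assoc, ← Matrix.mulVec_add]
    exact hv _
  have weight_le : edgeWeight wR wD (c + boundary₂ X Y *ᵥ v) ≤ (wD + wR) * hammingNorm c := by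
    have h₀ := hv 0
    rw [Matrix.mulVec_zero, add_zero] at h₀
    exact h₀.trans (edgeWeight_le_mul_hammingNorm wR wD c)
  have eq_zero := h.eq_zero_of_isLocallyMinimal cycle locallyMinimal <| by
    refine lt_of_le_of_lt ?_ hm
    rw [mul_assoc (12 * (wU : ℝ) * wL)]
    gcongr
    exact_mod_cast weight_le
  exact ⟨v, funext fun i => (CharTwo.add_eq_zero.1 (congrFun eq_zero i)).symm⟩

end ExpandsForward

/-- The bipartite graph with its two sides exchanged. -/
abbrev FreeBipartiteGraph.swap (X : FreeBipartiteGraph G) : FreeBipartiteGraph G where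
  V₀ := X.V₁
  V₁ := X.V₀
  E := flip X.E
  E_smul g x₁ x₀ := X.E_smul g x₀ x₁
  free₀ := X.free₁
  free₁ := X.free₀

theorem verticalEdge_swap {B : Type} [MulAction G B] :
    verticalEdge B X.swap.E = flip (verticalEdge (G := G) B X.E) := by
  ext z₁ z₀
  exact ⟨fun ⟨a₁, a₀, b, h, h₁, h₀⟩ => ⟨a₀, a₁, b, h, h₀, h₁⟩,
    fun ⟨a₀, a₁, b, h, h₀, h₁⟩ => ⟨a₁, a₀, b, h, h₁, h₀⟩⟩

theorem horizontalEdge_swap {A : Type} [MulAction G A] :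
    horizontalEdge A Y.swap.E = flip (horizontalEdge (G := G) A Y.E) := by
  ext z₁ z₀
  exact ⟨fun ⟨a, b₁, b₀, h, h₁, h₀⟩ => ⟨a, b₀, b₁, h, h₀, h₁⟩,
    fun ⟨a, b₀, b₁, h, h₀, h₁⟩ => ⟨a, b₁, b₀, h, h₁, h₀⟩⟩

theorem boundary₁_swap :
    boundary₁ X.swap Y.swap = (boundary₂ X Y)ᵀ.submatrix id (Equiv.sumComm _ _) := by
  ext z (p | q)
  · exact congrFun₂ (congrArg adjacency horizontalEdge_swap) z p
  · exact congrFun₂ (congrArg adjacency verticalEdge_swap) z q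

theorem boundary₂_swap :
    boundary₂ X.swap Y.swap = (boundary₁ X Y)ᵀ.submatrix (Equiv.sumComm _ _) id := by
  ext (p | q) v
  · exact congrFun₂ (congrArg adjacency verticalEdge_swap) p v
  · exact congrFun₂ (congrArg adjacency horizontalEdge_swap) q v

theorem ExpandsForward.exists_vecMul_boundary₁_eq
    (h : ExpandsForward X.swap Y.swap wU wD wL wR εV εH m) (hc : (boundary₂ X Y)ᵀ *ᵥ c = 0)
    (hm : 12 * wD * wR * (wU + wL) * (hammingNorm c : ℝ) < m) :
    ∃ u, u ᵥ* boundary₁ X Y = c := by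
  let e := Equiv.sumComm (BalancedVertex G X.V₀ Y.V₁) (BalancedVertex G X.V₁ Y.V₀)
  have cycle : boundary₁ X.swap Y.swap *ᵥ (c ∘ e) = 0 := by
    rw [boundary₁_swap, Matrix.submatrix_mulVec_equiv, Function.comp_assoc, e.self_comp_symm,
      Function.comp_id]
    exact hc
  have norm_eq : hammingNorm (c ∘ e) = hammingNorm c := by
    rw [hammingNorm_eq_add, add_comm, hammingNorm_eq_add c]
    rfl
  obtain ⟨u, hu⟩ := h.exists_boundary₂_mulVec_eq cycle (norm_eq ▸ hm)
  refine ⟨u, ?_⟩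
  rw [boundary₂_swap] at hu
  rw [← Matrix.mulVec_transpose]
  exact e.surjective.injective_comp_right hu

end Homology

section Parameters

namespace CSSCode

variable (C : CSSCode)

theorem maxWeight_le_iff {m n : Type} [Fintype m] [Fintype n] {H : Matrix m n (ZMod 2)} {w : ℕ} :
    maxWeight H ≤ w ↔ (∀ i, hammingNorm (H.row i) ≤ w) ∧ ∀ j, hammingNorm (H.col j) ≤ w := by
  simp only [maxWeight, max_le_iff, Finset.sup_le_iff, mem_univ, forall_const]
  rfl

theorem hammingNorm_row_le_maxWeight {m n : Type} [Fintype m] [Fintype n] (H : Matrix m n (ZMod 2))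
    (i : m) : hammingNorm (H.row i) ≤ maxWeight H :=
  (maxWeight_le_iff.1 le_rfl).1 i

theorem weight_eq_max [Nonempty C.XCheck] [Nonempty C.ZCheck] {wx wz : ℕ}
    (hx : ∀ i, hammingNorm (C.Hx.row i) = wx) (hz : ∀ i, hammingNorm (C.Hz.row i) = wz)
    (hx' : ∀ q, hammingNorm (C.Hx.col q) ≤ max wx wz)
    (hz' : ∀ q, hammingNorm (C.Hz.col q) ≤ max wx wz) : C.weight = max wx wz := by
  refine le_antisymm (max_le ?_ ?_) (max_le_max ?_ ?_)
  · exact maxWeight_le_iff.2 ⟨fun i => (hx i).trans_le (le_max_left _ _), hx'⟩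
  · exact maxWeight_le_iff.2 ⟨fun i => (hz i).trans_le (le_max_right _ _), hz'⟩
  · exact (hx (Classical.arbitrary _)).symm.trans_le (hammingNorm_row_le_maxWeight _ _)
  · exact (hz (Classical.arbitrary _)).symm.trans_le (hammingNorm_row_le_maxWeight _ _)

theorem length_le_dimension_add :
    C.length ≤ C.dimension + Fintype.card C.XCheck + Fintype.card C.ZCheck := by
  have hx : C.Hx.rank ≤ Fintype.card C.XCheck := Matrix.rank_le_card_height _
  have hz : C.Hz.rank ≤ Fintype.card C.ZCheck := Matrix.rank_le_card_height _
  rw [dimension]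
  lia

theorem exists_nontrivial (h : 0 < C.dimension) :
    ∃ a b, C.IsLogical a b ∧ ¬ C.IsTrivialLogical a b := by
  classical
  by_contra! trivial
  have ker_le : LinearMap.ker C.Hz.mulVecLin ≤ LinearMap.range C.Hx.vecMulLinear := fun a ha =>
    (trivial a 0 ⟨ha, Matrix.mulVec_zero _⟩).1
  have finrank_range : Module.finrank (ZMod 2) (LinearMap.range C.Hx.vecMulLinear) = C.Hx.rank := by
    rw [← Matrix.mulVecLin_transpose, ← Matrix.rank, Matrix.rank_transpose]
  have rank_add := LinearMap.finrank_range_add_finrank_ker C.Hz.mulVecLin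
  rw [Module.finrank_fintype_fun_eq_card, ← Matrix.rank] at rank_add
  have finrank_le := Submodule.finrank_mono ker_le
  rw [dimension, length] at h
  lia

theorem le_distance (h : 0 < C.dimension) {d : ℝ}
    (hX : ∀ a, C.Hz *ᵥ a = 0 → (hammingNorm a : ℝ) < d → ∃ u, u ᵥ* C.Hx = a)
    (hZ : ∀ b, C.Hx *ᵥ b = 0 → (hammingNorm b : ℝ) < d → ∃ v, v ᵥ* C.Hz = b) :
    d ≤ C.distance := by
  obtain ⟨a₀, b₀, h₀, h₀'⟩ := C.exists_nontrivial h
  obtain ⟨a, b, logical, nontrivial, hd⟩ :=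
    Nat.sInf_mem (s := {d | ∃ a b, C.IsLogical a b ∧ ¬ C.IsTrivialLogical a b ∧
      C.pauliWeight a b = d}) ⟨_, a₀, b₀, h₀, h₀', rfl⟩
  change C.pauliWeight a b = C.distance at hd
  by_contra! hlt
  rw [← hd] at hlt
  have ha : hammingNorm a ≤ C.pauliWeight a b :=
    card_le_card (monotone_filter_right _ fun _ _ => Or.inl)
  have hb : hammingNorm b ≤ C.pauliWeight a b :=
    card_le_card (monotone_filter_right _ fun _ _ => Or.inr)
  exact nontrivial ⟨hX a logical.1 (lt_of_le_of_lt (by exact_mod_cast ha) hlt),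
    hZ b logical.2 (lt_of_le_of_lt (by exact_mod_cast hb) hlt)⟩

end CSSCode

theorem IsBiregular.hammingNorm_col_adjacency {A B : Type} [Fintype A] [Fintype B]
    {E : A → B → Prop} {w₀ w₁ : ℕ} (h : IsBiregular E w₀ w₁) (a : A) :
    hammingNorm ((adjacency E).col a) = w₀ := by
  classical simp [hammingNorm, adjacency, ← h.1 a]

theorem IsBiregular.hammingNorm_row_adjacency {A B : Type} [Fintype A] [Fintype B]
    {E : A → B → Prop} {w₀ w₁ : ℕ} (h : IsBiregular E w₀ w₁) (b : B) :
    hammingNorm ((adjacency E).row b) = w₁ :=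
  h.flip.hammingNorm_col_adjacency b

variable {G : Type} [Group G] {X Y : FreeBipartiteGraph G} {wD wU wR wL : ℕ}

theorem isBiregular_verticalEdge {A : Type} [Fintype A] [MulAction G A] [IsCancelSMul G A]
    (hX : IsBiregular X.E wD wU) : IsBiregular (verticalEdge (G := G) A X.E) wD wU :=
  (isDisjointCopies_verticalEdge X).isBiregular hX

theorem isBiregular_horizontalEdge {A : Type} [Fintype A] [MulAction G A] [IsCancelSMul G A]
    (hY : IsBiregular Y.E wR wL) : IsBiregular (horizontalEdge (G := G) A Y.E) wR wL :=
  (isDisjointCopies_horizontalEdge Y).isBiregular hY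

theorem hammingNorm_row_boundary₁ (hX : IsBiregular X.E wD wU) (hY : IsBiregular Y.E wR wL)
    (v : BalancedVertex G X.V₁ Y.V₁) : hammingNorm ((boundary₁ X Y).row v) = wL + wU :=
  (hammingNorm_eq_add _).trans <| congrArg₂ (· + ·)
    ((isBiregular_horizontalEdge hY).hammingNorm_row_adjacency v)
    ((isBiregular_verticalEdge hX).hammingNorm_row_adjacency v)

theorem hammingNorm_col_boundary₁_le (hX : IsBiregular X.E wD wU) (hY : IsBiregular Y.E wR wL)
    (i : BalancedVertex G X.V₁ Y.V₀ ⊕ BalancedVertex G X.V₀ Y.V₁) :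
    hammingNorm ((boundary₁ X Y).col i) ≤ wR + wD := by
  obtain q | p := i
  · exact ((isBiregular_horizontalEdge hY).hammingNorm_col_adjacency q).trans_le (by lia)
  · exact ((isBiregular_verticalEdge hX).hammingNorm_col_adjacency p).trans_le (by lia)

theorem hammingNorm_col_boundary₂ (hX : IsBiregular X.E wD wU) (hY : IsBiregular Y.E wR wL)
    (z : BalancedVertex G X.V₀ Y.V₀) : hammingNorm ((boundary₂ X Y).col z) = wD + wR :=
  (hammingNorm_eq_add _).trans <| congrArg₂ (· + ·)
    ((isBiregular_verticalEdge hX).hammingNorm_col_adjacency z)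
    ((isBiregular_horizontalEdge hY).hammingNorm_col_adjacency z)

theorem hammingNorm_row_boundary₂_le (hX : IsBiregular X.E wD wU) (hY : IsBiregular Y.E wR wL)
    (i : BalancedVertex G X.V₁ Y.V₀ ⊕ BalancedVertex G X.V₀ Y.V₁) :
    hammingNorm ((boundary₂ X Y).row i) ≤ wU + wL := by
  obtain q | p := i
  · exact ((isBiregular_verticalEdge hX).hammingNorm_row_adjacency q).trans_le (by lia)
  · exact ((isBiregular_horizontalEdge hY).hammingNorm_row_adjacency p).trans_le (by lia)

theorem weight_balancedProductCode [Nonempty X.V₀] [Nonempty X.V₁] [Nonempty Y.V₀]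
    [Nonempty Y.V₁] (hX : IsBiregular X.E wD wU) (hY : IsBiregular Y.E wR wL) :
    (balancedProductCode X Y).weight = max (wL + wU) (wD + wR) := by
  have : Nonempty (balancedProductCode X Y).XCheck :=
    ⟨.mk G (Classical.arbitrary X.V₁) (Classical.arbitrary Y.V₁)⟩
  have : Nonempty (balancedProductCode X Y).ZCheck :=
    ⟨.mk G (Classical.arbitrary X.V₀) (Classical.arbitrary Y.V₀)⟩
  exact CSSCode.weight_eq_max _ (hammingNorm_row_boundary₁ hX hY) (hammingNorm_col_boundary₂ hX hY)
    (fun i => (hammingNorm_col_boundary₁_le hX hY i).trans (by lia))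
    (fun i => (hammingNorm_row_boundary₂_le hX hY i).trans (by lia))

theorem le_distance_balancedProductCode {εV εH m d : ℝ}
    (h : ExpandsForward X Y wD wU wR wL εV εH m)
    (h' : ExpandsForward X.swap Y.swap wU wD wL wR εV εH m)
    (hk : 0 < (balancedProductCode X Y).dimension) (hd : 12 * wU * wL * (wD + wR) * d ≤ m)
    (hd' : 12 * wD * wR * (wU + wL) * d ≤ m) : d ≤ (balancedProductCode X Y).distance := by
  have hD := h.down_pos
  have hU := h.up_pos
  have hR := h.right_pos
  have hL := h.left_pos
  refine CSSCode.le_distance _ hk (fun a ha had => ?_) fun b hb hbd => ?_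
  · exact h'.exists_vecMul_boundary₁_eq ha 
      ((mul_lt_mul_of_pos_left had (by positivity)).trans_le hd')
  · obtain ⟨v, hv⟩ := h.exists_boundary₂_mulVec_eq hb
      ((mul_lt_mul_of_pos_left hbd (by positivity)).trans_le hd)
    exact ⟨v, (Matrix.vecMul_transpose _ _).trans hv⟩

theorem length_balancedProductCode_mul_card [Fintype G] :
    ((balancedProductCode X Y).length * Fintype.card G : ℝ) =
      Fintype.card X.V₁ * Fintype.card Y.V₀ + Fintype.card X.V₀ * Fintype.card Y.V₁ := by
  norm_cast
  rw [← BalancedVertex.card_mul_card (G := G) (A := X.V₁) (B := Y.V₀),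
    ← BalancedVertex.card_mul_card (G := G) (A := X.V₀) (B := Y.V₁), ← add_mul, ← Fintype.card_sum]
  rfl

theorem le_dimension_balancedProductCode_mul_card [Fintype G] :
    ((Fintype.card X.V₁ - Fintype.card X.V₀) * (Fintype.card Y.V₀ - Fintype.card Y.V₁) : ℝ) ≤
      (balancedProductCode X Y).dimension * Fintype.card G := by
  have xCheck : (Fintype.card (balancedProductCode X Y).XCheck * Fintype.card G : ℝ) =
      Fintype.card X.V₁ * Fintype.card Y.V₁ := by
    exact_mod_cast BalancedVertex.card_mul_card
  have zCheck : (Fintype.card (balancedProductCode X Y).ZCheck * Fintype.card G : ℝ) =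
      Fintype.card X.V₀ * Fintype.card Y.V₀ := by
    exact_mod_cast BalancedVertex.card_mul_card
  have le : ((balancedProductCode X Y).length * Fintype.card G : ℝ) ≤
      ((balancedProductCode X Y).dimension + Fintype.card (balancedProductCode X Y).XCheck +
        Fintype.card (balancedProductCode X Y).ZCheck) * Fintype.card G := by
    gcongr
    exact_mod_cast CSSCode.length_le_dimension_add _
  linarith [length_balancedProductCode_mul_card (X := X) (Y := Y)]

theorem mul_length_le_mul_dimension [Finite G] (hX : IsBiregular X.E wD wU)
    (hY : IsBiregular Y.E wR wL) :
    ((wD - wU) * (wL - wR) : ℝ) * (balancedProductCode X Y).length ≤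
      (wD * wL + wU * wR) * (balancedProductCode X Y).dimension := by
  have := Fintype.ofFinite G
  have hG : (0 : ℝ) < Fintype.card G := by exact_mod_cast Fintype.card_pos
  have hX' : (wD * Fintype.card X.V₀ : ℝ) = wU * Fintype.card X.V₁ := by
    exact_mod_cast hX.card_mul_eq
  have hY' : (wR * Fintype.card Y.V₀ : ℝ) = wL * Fintype.card Y.V₁ := by
    exact_mod_cast hY.card_mul_eq
  refine le_of_mul_le_mul_right ?_ hG
  calc ((wD - wU) * (wL - wR) : ℝ) * (balancedProductCode X Y).length * Fintype.card G
      = (wD * wL + wU * wR) * ((Fintype.card X.V₁ - Fintype.card X.V₀) *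
          (Fintype.card Y.V₀ - Fintype.card Y.V₁)) := by
        rw [mul_assoc, length_balancedProductCode_mul_card]
        linear_combination (wL - wR) * (Fintype.card Y.V₀ + Fintype.card Y.V₁ : ℝ) * hX' -
          (Fintype.card X.V₁ - Fintype.card X.V₀) * (wD + wU : ℝ) * hY'
    _ ≤ (wD * wL + wU * wR) * ((balancedProductCode X Y).dimension * Fintype.card G) :=
        mul_le_mul_of_nonneg_left le_dimension_balancedProductCode_mul_card (by positivity)
    _ = _ := by ring

end Parameters

theorem IsBiregular.card_le_mul_card {A B : Type} [Fintype A] [Fintype B] {E : A → B → Prop}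
    {w₀ w₁ : ℕ} (h : IsBiregular E w₀ w₁) (h₁ : 0 < w₁) :
    Fintype.card B ≤ w₀ * Fintype.card A :=
  (Nat.le_mul_of_pos_left _ h₁).trans h.card_mul_eq.ge

/-- The data of Theorem 1 that do not depend on the group: the degrees, the expansion parameters and
the constants of the linear sizes of the two graphs, with the inequalities that make the distance
of the code linear. -/
structure ExpanderPairParams where
  (wDown wUp wRight wLeft : ℕ)
  (cV cH εV εH κ₁ κ₂ : ℝ)
  down_pos : 0 < wDown
  up_pos : 0 < wUp
  right_pos : 0 < wRight
  left_pos : 0 < wLeft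
  cV_pos : 0 < cV
  cH_pos : 0 < cH
  εV_pos : 0 < εV
  εH_pos : 0 < εH
  κ₁_pos : 0 < κ₁
  κ₂_pos : 0 < κ₂
  εV_le : εV ≤ 1 / 72
  εH_mul_down_le : εH * wDown ≤ 1 / 72
  εH_mul_up_le : εH * wUp ≤ 1 / 72

namespace ExpanderPairParams

variable (p : ExpanderPairParams) {G : Type} [Group G] [Fintype G]

/-- The lower bound of Theorem 1 for the rate of the code of an expander pair. -/
noncomputable def rate : ℝ :=
  ((p.wDown : ℝ) - p.wUp) * ((p.wLeft : ℝ) - p.wRight) /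
    ((p.wDown : ℝ) * p.wLeft + (p.wUp : ℝ) * p.wRight)

/-- In an expander pair for the group `G`, sets of fewer than `p.scale * |G|` vertices expand on
either side of both graphs. -/
noncomputable def scale : ℝ := min p.cV p.cH * p.κ₁ / (p.wUp * p.wLeft)

/-- A lower bound for the distance of the code of an expander pair, relative to the order of the
group. -/
noncomputable def distanceScale : ℝ :=
  p.scale / (12 * (p.wUp * p.wLeft * (p.wDown + p.wRight) +
    p.wDown * p.wRight * (p.wUp + p.wLeft)))

/-- An upper bound for the length of the code of an expander pair, relative to the order of the
group. -/
noncomputable def lengthScale : ℝ := (p.wDown + p.wRight) * p.κ₂ ^ 2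

/-- The graphs `X` and `Y` are two-sided lossless expanders of size `Θ(|G|)`, with the parameters
`p`. -/
structure IsExpanderPair (X Y : FreeBipartiteGraph G) : Prop where
  vertical : IsLosslessExpander X.E p.wDown p.wUp p.cV p.εV
  horizontal : IsLosslessExpander Y.E p.wRight p.wLeft p.cH p.εH
  le_card_vertical : p.κ₁ * Fintype.card G ≤ Fintype.card X.V₀
  card_vertical_le : Fintype.card X.V₀ ≤ p.κ₂ * Fintype.card G
  le_card_horizontal : p.κ₁ * Fintype.card G ≤ Fintype.card Y.V₀
  card_horizontal_le : Fintype.card Y.V₀ ≤ p.κ₂ * Fintype.card G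

theorem scale_pos : 0 < p.scale := by
  have := p.cV_pos
  have := p.cH_pos
  have := p.κ₁_pos
  have := p.up_pos
  have := p.left_pos
  unfold scale
  positivity

theorem lengthScale_pos : 0 < p.lengthScale := by
  have := p.down_pos
  have := p.κ₂_pos
  unfold lengthScale
  positivity

theorem distanceScale_pos : 0 < p.distanceScale := by
  have := p.scale_pos
  have := p.up_pos
  have := p.down_pos
  have := p.left_pos
  unfold distanceScale
  positivity

variable {p}

theorem scale_mul_le {c n N : ℝ} (hc : min p.cV p.cH ≤ c) (hn : 0 ≤ n)
    (hN : p.κ₁ * n ≤ p.wUp * p.wLeft * N) : p.scale * n ≤ c * N := by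
  have hmin : 0 < min p.cV p.cH := lt_min p.cV_pos p.cH_pos
  have hκ := p.κ₁_pos
  have hU : (0 : ℝ) < p.wUp := by exact_mod_cast p.up_pos
  have hL : (0 : ℝ) < p.wLeft := by exact_mod_cast p.left_pos
  calc p.scale * n = min p.cV p.cH * (p.κ₁ * n / (p.wUp * p.wLeft)) := by rw [scale]; ring
    _ ≤ c * N := by
      gcongr
      · exact hmin.le.trans hc
      · rwa [div_le_iff₀' (by positivity)]

namespace IsExpanderPair

variable {X Y : FreeBipartiteGraph G}

theorem card_V₀_le_up_mul (h : p.IsExpanderPair X Y) :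
    (Fintype.card X.V₀ : ℝ) ≤ p.wUp * Fintype.card X.V₁ := by
  exact_mod_cast h.vertical.1.flip.card_le_mul_card p.down_pos

theorem card_V₀_le_left_mul (h : p.IsExpanderPair X Y) :
    (Fintype.card Y.V₀ : ℝ) ≤ p.wLeft * Fintype.card Y.V₁ := by
  exact_mod_cast h.horizontal.1.flip.card_le_mul_card p.right_pos

theorem expandsForward (h : p.IsExpanderPair X Y) :
    ExpandsForward X Y p.wDown p.wUp p.wRight p.wLeft p.εV p.εH (p.scale * Fintype.card G) where
  vertical := h.vertical.expandsLosslessly <| scale_mul_le (min_le_left _ _) (by positivity) <|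
    h.le_card_vertical.trans <| le_mul_of_one_le_left (by positivity) <| by
      exact_mod_cast Nat.mul_pos p.up_pos p.left_pos
  horizontal := h.horizontal.expandsLosslessly <| scale_mul_le (min_le_right _ _) (by positivity) <|
    h.le_card_horizontal.trans <| le_mul_of_one_le_left (by positivity) <| by
      exact_mod_cast Nat.mul_pos p.up_pos p.left_pos
  down_pos := p.down_pos
  up_pos := p.up_pos
  right_pos := p.right_pos
  left_pos := p.left_pos
  εV_nonneg := p.εV_pos.le
  εV_le := p.εV_le
  εH_nonneg := p.εH_pos.le
  εH_mul_le := p.εH_mul_up_le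

theorem expandsForward_swap (h : p.IsExpanderPair X Y) :
    ExpandsForward X.swap Y.swap p.wUp p.wDown p.wLeft p.wRight p.εV p.εH
      (p.scale * Fintype.card G) where
  vertical := h.vertical.flip.expandsLosslessly <| scale_mul_le (min_le_left _ _) (by positivity) <|
    h.le_card_vertical.trans <| h.card_V₀_le_up_mul.trans <| by
      gcongr
      exact le_mul_of_one_le_right (by positivity) (by exact_mod_cast p.left_pos)
  horizontal := h.horizontal.flip.expandsLosslessly <|
    scale_mul_le (min_le_right _ _) (by positivity) <|
    h.le_card_horizontal.trans <| h.card_V₀_le_left_mul.trans <| by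
      gcongr
      exact le_mul_of_one_le_left (by positivity) (by exact_mod_cast p.up_pos)
  down_pos := p.up_pos
  up_pos := p.down_pos
  right_pos := p.left_pos
  left_pos := p.right_pos
  εV_nonneg := p.εV_pos.le
  εV_le := p.εV_le
  εH_nonneg := p.εH_pos.le
  εH_mul_le := p.εH_mul_down_le

theorem le_length (h : p.IsExpanderPair X Y) :
    p.κ₁ ^ 2 / p.wUp * Fintype.card G ≤ (balancedProductCode X Y).length := by
  have hκ := p.κ₁_pos
  have hU : (0 : ℝ) < p.wUp := by exact_mod_cast p.up_pos
  have hG : (0 : ℝ) < Fintype.card G := by exact_mod_cast Fintype.card_pos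
  have hX₁ : p.κ₁ * Fintype.card G / p.wUp ≤ Fintype.card X.V₁ := by
    rw [div_le_iff₀' hU]
    exact h.le_card_vertical.trans h.card_V₀_le_up_mul
  refine le_of_mul_le_mul_right ?_ hG
  calc p.κ₁ ^ 2 / p.wUp * Fintype.card G * Fintype.card G
      = p.κ₁ * Fintype.card G / p.wUp * (p.κ₁ * Fintype.card G) := by ring
    _ ≤ Fintype.card X.V₁ * Fintype.card Y.V₀ := by
      gcongr
      exact h.le_card_horizontal
    _ ≤ (balancedProductCode X Y).length * Fintype.card G := by
      rw [length_balancedProductCode_mul_card]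
      exact le_add_of_nonneg_right (by positivity)

theorem length_le (h : p.IsExpanderPair X Y) :
    (balancedProductCode X Y).length ≤ p.lengthScale * Fintype.card G := by
  have hκ := p.κ₂_pos
  have hG : (0 : ℝ) < Fintype.card G := by exact_mod_cast Fintype.card_pos
  have hX₁ : (Fintype.card X.V₁ : ℝ) ≤ p.wDown * Fintype.card X.V₀ := by
    exact_mod_cast h.vertical.1.card_le_mul_card p.up_pos
  have hY₁ : (Fintype.card Y.V₁ : ℝ) ≤ p.wRight * Fintype.card Y.V₀ := by
    exact_mod_cast h.horizontal.1.card_le_mul_card p.left_pos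
  refine le_of_mul_le_mul_right ?_ hG
  calc ((balancedProductCode X Y).length * Fintype.card G : ℝ)
      ≤ p.wDown * Fintype.card X.V₀ * Fintype.card Y.V₀ +
          Fintype.card X.V₀ * (p.wRight * Fintype.card Y.V₀) := by
        rw [length_balancedProductCode_mul_card]
        gcongr
    _ = (p.wDown + p.wRight) * (Fintype.card X.V₀ * Fintype.card Y.V₀) := by ring
    _ ≤ (p.wDown + p.wRight) * ((p.κ₂ * Fintype.card G) * (p.κ₂ * Fintype.card G)) := by
        gcongr
        · exact h.card_vertical_le
        · exact h.card_horizontal_le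
    _ = p.lengthScale * Fintype.card G * Fintype.card G := by rw [lengthScale]; ring

theorem length_pos (h : p.IsExpanderPair X Y) : (0 : ℝ) < (balancedProductCode X Y).length := by
  have hκ := p.κ₁_pos
  have hU := p.up_pos
  exact h.le_length.trans_lt' (by positivity)

theorem rate_le (h : p.IsExpanderPair X Y) :
    p.rate ≤ (balancedProductCode X Y).dimension / (balancedProductCode X Y).length := by
  have hD := p.down_pos
  have hL := p.left_pos
  rw [rate, div_le_div_iff₀ (by positivity) h.length_pos,
    mul_comm ((balancedProductCode X Y).dimension : ℝ)]
  exact mul_length_le_mul_dimension h.vertical.1 h.horizontal.1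

theorem le_distance (h : p.IsExpanderPair X Y) (hp : 0 < p.rate) :
    p.distanceScale * Fintype.card G ≤ (balancedProductCode X Y).distance := by
  have hD : (0 : ℝ) < p.wDown := by exact_mod_cast p.down_pos
  have hU : (0 : ℝ) < p.wUp := by exact_mod_cast p.up_pos
  have hR : (0 : ℝ) < p.wRight := by exact_mod_cast p.right_pos
  have hL : (0 : ℝ) < p.wLeft := by exact_mod_cast p.left_pos
  have hd : 0 ≤ p.distanceScale * Fintype.card G := by
    have := p.distanceScale_pos
    positivity
  have dimension_pos : 0 < (balancedProductCode X Y).dimension := by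
    exact_mod_cast (div_pos_iff_of_pos_right h.length_pos).1 (hp.trans_le h.rate_le)
  have scale_eq : 12 * (p.wUp * p.wLeft * (p.wDown + p.wRight) +
      p.wDown * p.wRight * (p.wUp + p.wLeft)) * (p.distanceScale * Fintype.card G) =
        p.scale * Fintype.card G := by
    rw [distanceScale]
    field_simp
  refine le_distance_balancedProductCode h.expandsForward h.expandsForward_swap dimension_pos
    ?_ ?_ <;> rw [← scale_eq] <;> gcongr ?_ * _ <;> rw [mul_add]
  · linarith [show (0 : ℝ) ≤ p.wDown * p.wRight * (p.wUp + p.wLeft) by positivity]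
  · linarith [show (0 : ℝ) ≤ p.wUp * p.wLeft * (p.wDown + p.wRight) by positivity]

theorem le_distance_div_length (h : p.IsExpanderPair X Y) (hp : 0 < p.rate) :
    p.distanceScale / p.lengthScale ≤
      (balancedProductCode X Y).distance / (balancedProductCode X Y).length := by
  rw [div_le_div_iff₀ p.lengthScale_pos h.length_pos]
  calc p.distanceScale * (balancedProductCode X Y).length
      ≤ p.distanceScale * (p.lengthScale * Fintype.card G) :=
        mul_le_mul_of_nonneg_left h.length_le p.distanceScale_pos.le
    _ = p.distanceScale * Fintype.card G * p.lengthScale := by ring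
    _ ≤ _ := mul_le_mul_of_nonneg_right (h.le_distance hp) p.lengthScale_pos.le

theorem weight_eq (h : p.IsExpanderPair X Y) :
    (balancedProductCode X Y).weight = max (p.wLeft + p.wUp) (p.wDown + p.wRight) := by
  have hG : (0 : ℝ) < p.κ₁ * Fintype.card G :=
    mul_pos p.κ₁_pos (by exact_mod_cast Fintype.card_pos)
  have hX : 0 < Fintype.card X.V₀ := by exact_mod_cast hG.trans_le h.le_card_vertical
  have hY : 0 < Fintype.card Y.V₀ := by exact_mod_cast hG.trans_le h.le_card_horizontal
  have : Nonempty X.V₀ := Fintype.card_pos_iff.1 hX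
  have : Nonempty Y.V₀ := Fintype.card_pos_iff.1 hY
  have : Nonempty X.V₁ := Fintype.card_pos_iff.1 <| Nat.pos_of_mul_pos_left <|
    hX.trans_le (h.vertical.1.flip.card_le_mul_card p.down_pos)
  have : Nonempty Y.V₁ := Fintype.card_pos_iff.1 <| Nat.pos_of_mul_pos_left <|
    hY.trans_le (h.horizontal.1.flip.card_le_mul_card p.right_pos)
  exact weight_balancedProductCode h.vertical.1 h.horizontal.1

end IsExpanderPair

theorem tendsto_length {G : ℕ → Type} [∀ i, Group (G i)] [∀ i, Fintype (G i)]
    {X Y : ∀ i, FreeBipartiteGraph (G i)} (h : ∀ i, p.IsExpanderPair (X i) (Y i))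
    (hG : Tendsto (fun i => Fintype.card (G i)) atTop atTop) :
    Tendsto (fun i => (balancedProductCode (X i) (Y i)).length) atTop atTop := by
  have hκ : (0 : ℝ) < p.κ₁ ^ 2 / p.wUp := by
    have := p.κ₁_pos
    have := p.up_pos
    positivity
  exact tendsto_natCast_atTop_iff.1 <| tendsto_atTop_mono (fun i => (h i).le_length) <|
    (tendsto_natCast_atTop_atTop.comp hG).const_mul_atTop hκ

end ExpanderPairParams

section Families

variable {G : ℕ → Type} [∀ i, Group (G i)] [∀ i, Fintype (G i)]

/-- All but finitely many of the groups `G i` act freely on a two-sided lossless expander with the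
given parameters and between `κ₁ * |G i|` and `κ₂ * |G i|` vertices in `V₀`. -/
def HasExpanderFamily (G : ℕ → Type) [∀ i, Group (G i)] [∀ i, Fintype (G i)] (w₀ w₁ : ℕ)
    (c ε κ₁ κ₂ : ℝ) : Prop :=
  ∀ᶠ i in atTop, ∃ X : FreeBipartiteGraph (G i), IsLosslessExpander X.E w₀ w₁ c ε ∧
    κ₁ * Fintype.card (G i) ≤ Fintype.card X.V₀ ∧ Fintype.card X.V₀ ≤ κ₂ * Fintype.card (G i)

namespace HasExpanderFamily

variable {w₀ w₁ : ℕ} {c ε κ₁ κ₂ : ℝ}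

theorem mono (h : HasExpanderFamily G w₀ w₁ c ε κ₁ κ₂) {κ₁' κ₂' : ℝ} (h₁ : κ₁' ≤ κ₁)
    (h₂ : κ₂ ≤ κ₂') : HasExpanderFamily G w₀ w₁ c ε κ₁' κ₂' := by
  filter_upwards [h] with i ⟨X, hX, le_card, card_le⟩
  exact ⟨X, hX, le_card.trans' (by gcongr), card_le.trans (by gcongr)⟩

theorem swap (h : HasExpanderFamily G w₀ w₁ c ε κ₁ κ₂) (h₀ : 0 < w₀) (h₁ : 0 < w₁) :
    HasExpanderFamily G w₁ w₀ c ε (κ₁ / w₁) (w₀ * κ₂) := by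
  filter_upwards [h] with i ⟨X, hX, le_card, card_le⟩
  refine ⟨X.swap, hX.flip, ?_, ?_⟩
  · rw [div_mul_eq_mul_div, div_le_iff₀' (by positivity)]
    exact le_card.trans (by exact_mod_cast hX.1.flip.card_le_mul_card h₀)
  · calc (Fintype.card X.V₁ : ℝ) ≤ w₀ * Fintype.card X.V₀ := by
          exact_mod_cast hX.1.card_le_mul_card h₁
      _ ≤ w₀ * κ₂ * Fintype.card (G i) := by
          rw [mul_assoc]
          gcongr

end HasExpanderFamily

theorem ExpanderPairParams.exists_isExpanderPair (p : ExpanderPairParams)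
    (hX : HasExpanderFamily G p.wDown p.wUp p.cV p.εV p.κ₁ p.κ₂)
    (hY : HasExpanderFamily G p.wRight p.wLeft p.cH p.εH p.κ₁ p.κ₂) :
    ∃ N, ∃ X Y : ∀ i, FreeBipartiteGraph (G (i + N)), ∀ i, p.IsExpanderPair (X i) (Y i) := by
  obtain ⟨N, hN⟩ := eventually_atTop.1 (hX.and hY)
  choose X hX hX' hX'' using fun i => (hN (i + N) (Nat.le_add_left _ _)).1
  choose Y hY hY' hY'' using fun i => (hN (i + N) (Nat.le_add_left _ _)).2
  exact ⟨N, X, Y, fun i => ⟨hX i, hY i, hX' i, hX'' i, hY' i, hY'' i⟩⟩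

theorem LosslessExpanderConjecture.exists_hasExpanderFamily (hconj : LosslessExpanderConjecture)
    {a b : ℝ} (ha : 0 ≤ a) (hab : a < b) (hb : b ≤ 1) :
    ∃ (G : ℕ → Type) (_ : ∀ i, Group (G i)) (_ : ∀ i, Fintype (G i)),
      Tendsto (fun i => Fintype.card (G i)) atTop atTop ∧
      ∀ ε : ℝ, 0 < ε → ∃ (w₀ w₁ : ℕ) (c κ₁ κ₂ : ℝ), 0 < w₀ ∧ 0 < w₁ ∧ 0 < c ∧ 0 < κ₁ ∧ 0 < κ₂ ∧
        a * w₁ ≤ w₀ ∧ w₀ ≤ b * w₁ ∧ HasExpanderFamily G w₀ w₁ c ε κ₁ κ₂ := by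
  obtain ⟨G, hGroup, hFintype, hG, expanders⟩ := hconj
  refine ⟨G, hGroup, hFintype, hG, fun ε hε => ?_⟩
  obtain ⟨w₀, w₁, c, κ₁, κ₂, i₀, hc, hκ₁, ha', hb', family⟩ := expanders ε hε a b ha hab hb
  have h₀ : w₀ ≠ 0 := by rintro rfl; norm_num at ha'; linarith
  have h₁ : w₁ ≠ 0 := by rintro rfl; norm_num at ha'; linarith
  have h₁' : (0 : ℝ) < w₁ := by positivity
  have family : HasExpanderFamily G w₀ w₁ c ε κ₁ κ₂ := eventually_atTop.2 ⟨i₀, family⟩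
  exact ⟨w₀, w₁, c, κ₁, max 1 κ₂, Nat.pos_of_ne_zero h₀, Nat.pos_of_ne_zero h₁, hc, hκ₁,
    by positivity, ((lt_div_iff₀ h₁').1 ha').le, ((div_lt_iff₀ h₁').1 hb').le,
    family.mono le_rfl (le_max_right _ _)⟩

end Families

theorem le_sub_mul_sub_div_mul_add_mul {r D U R L : ℝ} (hr : r < 1) (hD : 0 < D) (hU : 0 ≤ U)
    (hR : 0 ≤ R) (hL : 0 < L) (hUD : U ≤ (1 - r) / 2 * D) (hRL : R ≤ (1 - r) / 2 * L) :
    r ≤ (D - U) * (L - R) / (D * L + U * R) := by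
  rw [le_div_iff₀ (by positivity)]
  have hUL : U * L ≤ (1 - r) / 2 * D * L := by gcongr
  have hDR : D * R ≤ D * ((1 - r) / 2 * L) := by gcongr
  have hUR : 0 ≤ (1 - r) * (U * R) := mul_nonneg (by linarith) (by positivity)
  linarith

theorem LosslessExpanderConjecture.exists_isExpanderPair (hconj : LosslessExpanderConjecture)
    {r : ℝ} (hr₀ : 0 < r) (hr₁ : r < 1) :
    ∃ p : ExpanderPairParams, r ≤ p.rate ∧ p.εV * p.wDown ≤ p.wUp ∧ p.εV * p.wUp ≤ p.wDown ∧
      ∃ (G : ℕ → Type) (_ : ∀ i, Group (G i)) (_ : ∀ i, Fintype (G i))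
        (X Y : ∀ i, FreeBipartiteGraph (G i)), (∀ i, p.IsExpanderPair (X i) (Y i)) ∧
        Tendsto (fun i => Fintype.card (G i)) atTop atTop := by
  have ha : 0 < (1 - r) / 4 := by linarith
  obtain ⟨G, _, _, hG, expanders⟩ := hconj.exists_hasExpanderFamily (a := (1 - r) / 4)
    (b := (1 - r) / 2) ha.le (by linarith) (by linarith)
  have hεV : 0 < min (1 / 72) ((1 - r) / 4) := lt_min (by norm_num) ha
  obtain ⟨wU, wD, cV, κ₁, κ₂, hU, hD, hcV, hκ₁, -, le_wU, wU_le, familyX⟩ := expanders _ hεV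
  have hεH : (0 : ℝ) < 1 / (72 * wD) := by positivity
  obtain ⟨wR, wL, cH, ν₁, ν₂, hR, hL, hcH, hν₁, hν₂, -, wR_le, familyY⟩ := expanders _ hεH
  have wU_le_wD : (wU : ℝ) ≤ wD :=
    wU_le.trans (mul_le_of_le_one_left (by positivity) (by linarith))
  have εH_mul_down : 1 / (72 * wD) * wD = (1 / 72 : ℝ) := by field_simp
  let p : ExpanderPairParams :=
    { wDown := wD, wUp := wU, wRight := wR, wLeft := wL, cV := cV, cH := cH
      εV := min (1 / 72) ((1 - r) / 4), εH := 1 / (72 * wD)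
      κ₁ := min (κ₁ / wD) ν₁, κ₂ := max (wU * κ₂) ν₂
      down_pos := hD, up_pos := hU, right_pos := hR, left_pos := hL, cV_pos := hcV, cH_pos := hcH
      εV_pos := hεV, εH_pos := hεH, κ₁_pos := lt_min (by positivity) hν₁
      κ₂_pos := lt_max_of_lt_right hν₂, εV_le := min_le_left _ _
      εH_mul_down_le := εH_mul_down.le
      εH_mul_up_le := (mul_le_mul_of_nonneg_left wU_le_wD hεH.le).trans εH_mul_down.le }
  obtain ⟨N, X, Y, pair⟩ := p.exists_isExpanderPair
    ((familyX.swap hU hD).mono (min_le_left _ _) (le_max_left _ _))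
    (familyY.mono (min_le_right _ _) (le_max_right _ _))
  refine ⟨p, ?_, ?_, ?_, fun i => G (i + N), inferInstance, inferInstance, X, Y, pair,
    hG.comp (tendsto_add_atTop_nat N)⟩
  · exact le_sub_mul_sub_div_mul_add_mul hr₁ (by exact_mod_cast hD) (by positivity) (by positivity)
      (by exact_mod_cast hL) wU_le wR_le
  · exact le_wU.trans' (mul_le_mul_of_nonneg_right (min_le_right _ _) (by positivity))
  · exact (mul_le_of_le_one_left (by positivity) ((min_le_left _ _).trans (by norm_num))).trans
      wU_le_wD

theorem theorem1 (hconj : LosslessExpanderConjecture) (r : ℝ) (hr₀ : 0 < r) (hr₁ : r < 1) :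
    ∃ (δ : ℝ) (w : ℕ), 0 < δ ∧
      -- the degrees, the expansion parameters and the constants of the linear size
      ∃ (wDown wUp wRight wLeft : ℕ) (cV cH εV εH κ₁ κ₂ : ℝ),
        0 < cV ∧ 0 < cH ∧ 0 < εV ∧ 0 < εH ∧ 0 < κ₁ ∧
        r ≤ ((wDown : ℝ) - wUp) * ((wLeft : ℝ) - wRight) /
          ((wDown : ℝ) * wLeft + (wUp : ℝ) * wRight) ∧
        εV * wDown ≤ wUp ∧ εV * wUp ≤ wDown ∧
        wUp * εH < 1 / 12 ∧ wDown * εH < 1 / 12 ∧ εV < 1 / 12 ∧ εH < 1 / 12 ∧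
        -- the groups and the graphs whose balanced products give the codes
        ∃ (G : ℕ → Type) (_ : ∀ i, Group (G i)) (_ : ∀ i, Fintype (G i))
          (X Y : ∀ i, FreeBipartiteGraph (G i)),
          (∀ i, IsLosslessExpander (X i).E wDown wUp cV εV ∧
            IsLosslessExpander (Y i).E wRight wLeft cH εH ∧
            κ₁ * Fintype.card (G i) ≤ Fintype.card (X i).V₀ ∧
            Fintype.card (X i).V₀ ≤ κ₂ * Fintype.card (G i) ∧
            κ₁ * Fintype.card (G i) ≤ Fintype.card (Y i).V₀ ∧
            Fintype.card (Y i).V₀ ≤ κ₂ * Fintype.card (G i)) ∧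
          Tendsto (fun i => Fintype.card (G i)) atTop atTop ∧
          -- the parameters of the codes
          Tendsto (fun i => (balancedProductCode (X i) (Y i)).length) atTop atTop ∧
          ∀ i, r ≤ ((balancedProductCode (X i) (Y i)).dimension : ℝ) /
              (balancedProductCode (X i) (Y i)).length ∧
            δ ≤ ((balancedProductCode (X i) (Y i)).distance : ℝ) /
              (balancedProductCode (X i) (Y i)).length ∧
            (balancedProductCode (X i) (Y i)).weight = w := by
  obtain ⟨p, rate, hDown, hUp, G, _, _, X, Y, pair, hG⟩ := hconj.exists_isExpanderPair hr₀ hr₁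
  have rate_pos : 0 < p.rate := hr₀.trans_le rate
  have εH_lt : p.εH < 1 / 12 := by
    have := le_mul_of_one_le_right p.εH_pos.le (by exact_mod_cast p.down_pos : (1 : ℝ) ≤ p.wDown)
    linarith [p.εH_mul_down_le]
  refine ⟨p.distanceScale / p.lengthScale, max (p.wLeft + p.wUp) (p.wDown + p.wRight),
    div_pos p.distanceScale_pos p.lengthScale_pos, p.wDown, p.wUp, p.wRight, p.wLeft, p.cV, p.cH,
    p.εV, p.εH, p.κ₁, p.κ₂, p.cV_pos, p.cH_pos, p.εV_pos, p.εH_pos, p.κ₁_pos, rate, hDown, hUp,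
    by linarith [p.εH_mul_up_le], by linarith [p.εH_mul_down_le], by linarith [p.εV_le], εH_lt,
    G, _, _, X, Y, fun i => ?_, hG, p.tendsto_length pair hG, fun i => ⟨?_, ?_, (pair i).weight_eq⟩⟩
  · exact ⟨(pair i).vertical, (pair i).horizontal, (pair i).le_card_vertical,
      (pair i).card_vertical_le, (pair i).le_card_horizontal, (pair i).card_horizontal_le⟩
  · exact rate.trans (pair i).rate_le
  · exact (pair i).le_distance_div_length rate_pos
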